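/- Let $n\ge m$, let $p_{ij}\ge 0$ be the processing time of job $j\in[n]$ on machine $i\in[m]$, and let $f:\mathbb R^m\to\mathbb R_+$ be a monotone, symmetric norm: $f$ is a norm that is invariant under permutations of the coordinates, and $f(v)\le f(w)$ whenever $v_i(w_i-v_i)\ge 0$ for all $i$. A tuple $(x,\vec L,\vec P,T)$ is feasible for (CP) if $x_{ij}\ge 0$ for all $i,j$; $\sum_i x_{ij}\ge 1$ for every job $j$; $L_i=\sum_j p_{ij}x_{ij}$ for all $i$; $P_j=\sum_i p_{ij}x_{ij}$ for all $j$; $f(\vec L)\le T$; and $f\bigl((P_j)_{j\in S}\bigr)\le T$ for every set $S$ of exactly $m$ jobs. For an assignment $\sigma:[n]\to[m]$ let $\mathrm{load}_\sigma(i)=\sum_{j:\sigma(j)=i}p_{ij}$. There is an algorithm which, given rational $p\ge 0$ and rational $x\ge 0$ with $\sum_i x_{ij}\ge 1$ for all $j$, runs in time polynomial in the total binary encoding length of $(m,n,p,x)$ and outputs an assignment $\sigma:[n]\to[m]$ such that, with $P_j=\sum_i p_{ij}x_{ij}$, and with $\hat x_{ij}=2x_{ij}$ if $p_{ij}\le 2P_j$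 and $\hat x_{ij}=0$ otherwise: 1. $\hat x_{\sigma(j)j}>0$ for every job $j$ (so that $p_{\sigma(j)j}\le 2P_j$); 2. $\mathrm{load}_\sigma(i)\le\sum_j p_{ij}\hat x_{ij}+\max_{j:\sigma(j)=i}p_{ij}$ for every machine $i$ (the maximum is $0$ if no job is assigned to $i$); 3. for every monotone, symmetric norm $f$ on $\mathbb R^m$ and all $\vec L,\vec P,T$ such that $(x,\vec L,\vec P,T)$ is feasible for (CP) with respect to $f$, we have $f(\mathrm{load}_\sigma)\le 4T$. In particular the algorithm is oblivious to the norm: it is given neither $f$ nor $T$, and the same $\sigma$ works for all $f$. For arbitrary real $p\ge 0$ and real $x\ge 0$ with $\sum_i x_{ij}\ge 1$ for all $j$, an assignment $\sigma$ with properties 1-3 exists. -/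

import Mathlib

namespace MinNorm

/-! ### Monotone symmetric norms and the convex program -/

/-- `f` is a monotone, symmetric norm on `ℝ^m`. -/
structure IsMonotoneSymmetricNorm {m : ℕ} (f : (Fin m → ℝ) → ℝ) : Prop where
  eq_zero_iff : ∀ v, f v = 0 ↔ v = 0
  triangle : ∀ v w, f (v + w) ≤ f v + f w
  homogeneous : ∀ (c : ℝ) (v), f (c • v) = |c| * f v
  monotone : ∀ v w : Fin m → ℝ, (∀ i, 0 ≤ v i * (w i - v i)) → f v ≤ f w
  symmetric : ∀ (π : Equiv.Perm (Fin m)) (v), f (fun i => v (π i)) = f v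

/-- The linear constraints on the assignment variables: `x ≥ 0` and `∑ i, x i j ≥ 1` for every
job `j`. -/
structure IsFractionalAssignment {m n : ℕ} (x : Fin m → Fin n → ℝ) : Prop where
  nonneg : ∀ i j, 0 ≤ x i j
  covers : ∀ j, 1 ≤ ∑ i, x i j

/-- The load `L_i(x)` of machine `i` under a fractional assignment. -/
def machineLoad {m n : ℕ} (p x : Fin m → Fin n → ℝ) (i : Fin m) : ℝ := ∑ j, p i j * x i j

/-- The cost `P_j(x)` of job `j` under a fractional assignment. -/
def jobCost {m n : ℕ} (p x : Fin m → Fin n → ℝ) (j : Fin n) : ℝ := ∑ i, p i j * x i j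

/-- `(x, L, P, T)` is a feasible solution of the convex program for the norm `f` and the
processing times `p`. For a set `S` of `m` jobs the vector `P_S ∈ ℝ^m` lists the `P_j`, `j ∈ S`,
in increasing order of `j`; for symmetric `f` the order does not matter. -/
structure CPFeasible {m n : ℕ} (f : (Fin m → ℝ) → ℝ) (p x : Fin m → Fin n → ℝ)
    (L : Fin m → ℝ) (P : Fin n → ℝ) (T : ℝ) : Prop where
  assignment : IsFractionalAssignment x
  load_eq : ∀ i, L i = machineLoad p x i
  cost_eq : ∀ j, P j = jobCost p x j
  norm_load_le : f L ≤ T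
  norm_cost_le : ∀ (S : Finset (Fin n)) (hS : S.card = m),
    f (fun i => P (S.orderEmbOfFin hS i)) ≤ T

/-- The load vector of an (integral) assignment `σ` of jobs to machines. -/
def load {m n : ℕ} (p : Fin m → Fin n → ℝ) (σ : Fin n → Fin m) (i : Fin m) : ℝ :=
  ∑ j with σ j = i, p i j

/-- The length of a longest job assigned by `σ` to machine `i` (`0` if there is none). -/
noncomputable def longestJob {m n : ℕ} (p : Fin m → Fin n → ℝ) (σ : Fin n → Fin m)
    (i : Fin m) : ℝ :=
  Finset.fold max 0 (p i) {j | σ j = i}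

/-- The filtered solution: `2 x_ij` where `p_ij ≤ 2 P_j`, and `0` elsewhere. -/
noncomputable def filtered {m n : ℕ} (p x : Fin m → Fin n → ℝ) (i : Fin m) (j : Fin n) : ℝ :=
  open Classical in if p i j ≤ 2 * jobCost p x j then 2 * x i j else 0

/-- What the rounding of `x` into `σ` guarantees: the assignment lives on the support of the
filtered solution, has the Shmoys-Tardos load bound with respect to it, and loses a factor of at
most `4` for every monotone symmetric norm and every value `T` feasible for that norm. -/
structure IsRounding {m n : ℕ} (p x : Fin m → Fin n → ℝ) (σ : Fin n → Fin m) : Prop where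
  support : ∀ j, 0 < filtered p x (σ j) j
  load_le : ∀ i, load p σ i ≤ machineLoad p (filtered p x) i + longestJob p σ i
  norm_le : ∀ f : (Fin m → ℝ) → ℝ, IsMonotoneSymmetricNorm f →
    ∀ (L : Fin m → ℝ) (P : Fin n → ℝ) (T : ℝ), CPFeasible f p x L P T → f (load p σ) ≤ 4 * T

/-! ### Random access machines with logarithmic cost

Programs are structured (`while`) programs over finitely many integer arrays with indirect
addressing. Every operation is charged the bit lengths of its operands, every memory access the
bit lengths of the address and of the value. -/

/-- Number of bits of an integer in signed binary notation. -/
def bitLen (z : ℤ) : ℕ := z.natAbs.size + 1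

/-- The memory: `M a k` is the entry with index `k` of the array with name `a`. -/
abbrev Mem := ℕ → ℤ → ℤ

/-- The arithmetic instructions. -/
inductive Op
  | add
  | sub
  | mul
  | div

/-- The value of an arithmetic instruction (`div` is integer division). -/
def Op.eval : Op → ℤ → ℤ → ℤ
  | .add, u, v => u + v
  | .sub, u, v => u - v
  | .mul, u, v => u * v
  | .div, u, v => u / v

/-- Expressions: constants, array accesses `a[e]`, and arithmetic. -/
inductive Expr
  | const (c : ℤ)
  | get (a : ℕ) (e : Expr)
  | op (o : Op) (e₁ e₂ : Expr)

/-- The value of an expression. -/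
def Expr.eval (M : Mem) : Expr → ℤ
  | .const c => c
  | .get a e => M a (e.eval M)
  | .op o e₁ e₂ => o.eval (e₁.eval M) (e₂.eval M)

/-- The time needed to evaluate an expression. -/
def Expr.cost (M : Mem) : Expr → ℕ
  | .const c => bitLen c
  | .get a e => e.cost M + bitLen (e.eval M) + bitLen (M a (e.eval M))
  | .op _ e₁ e₂ => e₁.cost M + e₂.cost M + bitLen (e₁.eval M) + bitLen (e₂.eval M)

/-- Programs. `assign a k e` is `a[k] := e`; the tests of `ite` and `loop` are `0 < e`, and `loop`
is the `while` loop. -/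
inductive Prog
  | skip
  | assign (a : ℕ) (k e : Expr)
  | seq (c₁ c₂ : Prog)
  | ite (e : Expr) (c₁ c₂ : Prog)
  | loop (e : Expr) (c : Prog)

/-- Writing `v` into `a[k]`. -/
def Mem.write (M : Mem) (a : ℕ) (k v : ℤ) : Mem :=
  Function.update M a (Function.update (M a) k v)

/-- `Exec c M M' t`: started on the memory `M`, the program `c` halts with memory `M'` after
time `t`. -/
inductive Exec : Prog → Mem → Mem → ℕ → Prop
  | skip (M : Mem) : Exec .skip M M 1
  | assign (M : Mem) (a : ℕ) (k e : Expr) :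
      Exec (.assign a k e) M (M.write a (k.eval M) (e.eval M))
        (k.cost M + e.cost M + bitLen (k.eval M) + bitLen (e.eval M))
  | seq {c₁ c₂ : Prog} {M M₁ M₂ : Mem} {t₁ t₂ : ℕ} :
      Exec c₁ M M₁ t₁ → Exec c₂ M₁ M₂ t₂ → Exec (.seq c₁ c₂) M M₂ (t₁ + t₂)
  | ite_pos {e : Expr} {c₁ c₂ : Prog} {M M' : Mem} {t : ℕ} :
      0 < e.eval M → Exec c₁ M M' t → Exec (.ite e c₁ c₂) M M' (e.cost M + 1 + t)
  | ite_neg {e : Expr} {c₁ c₂ : Prog} {M M' : Mem} {t : ℕ} :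
      ¬ 0 < e.eval M → Exec c₂ M M' t → Exec (.ite e c₁ c₂) M M' (e.cost M + 1 + t)
  | loop_done {e : Expr} {c : Prog} {M : Mem} :
      ¬ 0 < e.eval M → Exec (.loop e c) M M (e.cost M + 1)
  | loop_step {e : Expr} {c : Prog} {M M₁ M₂ : Mem} {t₁ t₂ : ℕ} :
      0 < e.eval M → Exec c M M₁ t₁ → Exec (.loop e c) M₁ M₂ t₂ →
        Exec (.loop e c) M M₂ (e.cost M + 1 + t₁ + t₂)

/-- The machine is deterministic: result and running time are determined by program and input. -/
theorem Exec.deterministic {c : Prog} {M M₁ M₂ : Mem} {t₁ t₂ : ℕ}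
    (h₁ : Exec c M M₁ t₁) (h₂ : Exec c M M₂ t₂) : M₁ = M₂ ∧ t₁ = t₂ := by
  induction h₁ generalizing M₂ t₂ with
  | skip M => cases h₂; exact ⟨rfl, rfl⟩
  | assign M a k e => cases h₂; exact ⟨rfl, rfl⟩
  | seq _ _ ih₁ ih₂ =>
    cases h₂ with
    | seq g₁ g₂ =>
      obtain ⟨rfl, rfl⟩ := ih₁ g₁
      obtain ⟨rfl, rfl⟩ := ih₂ g₂
      exact ⟨rfl, rfl⟩
  | ite_pos h _ ih =>
    cases h₂ with
    | ite_pos _ g => obtain ⟨rfl, rfl⟩ := ih g; exact ⟨rfl, rfl⟩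
    | ite_neg h' _ => exact absurd h h'
  | ite_neg h _ ih =>
    cases h₂ with
    | ite_pos h' _ => exact absurd h' h
    | ite_neg _ g => obtain ⟨rfl, rfl⟩ := ih g; exact ⟨rfl, rfl⟩
  | loop_done h =>
    cases h₂ with
    | loop_done _ => exact ⟨rfl, rfl⟩
    | loop_step h' _ _ => exact absurd h' h
  | loop_step h _ _ ih₁ ih₂ =>
    cases h₂ with
    | loop_done h' => exact absurd h h'
    | loop_step _ g₁ g₂ =>
      obtain ⟨rfl, rfl⟩ := ih₁ g₁
      obtain ⟨rfl, rfl⟩ := ih₂ g₂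
      exact ⟨rfl, rfl⟩

/-! ### Input and output of the rounding algorithm -/

/-- An `m × n` table stored row by row: entry `(i, j)` has index `i * n + j`, and all other
entries of the array are `0`. -/
def rowMajor {m n : ℕ} (A : Fin m → Fin n → ℤ) (k : ℤ) : ℤ :=
  ∑ i : Fin m, ∑ j : Fin n, if k = (i : ℤ) * n + j then A i j else 0

/-- The initial memory for rational processing times `p` and a rational fractional assignment `x`:
array `0` holds `m` and `n`, arrays `1` and `2` the numerators and denominators of `p`, arrays `3`
and `4` those of `x`. Everything else is `0`. -/
def inputMem {m n : ℕ} (p x : Fin m → Fin n → ℚ) : Mem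
  | 0, k => if k = 0 then m else if k = 1 then n else 0
  | 1, k => rowMajor (fun i j => (p i j).num) k
  | 2, k => rowMajor (fun i j => ((p i j).den : ℤ)) k
  | 3, k => rowMajor (fun i j => (x i j).num) k
  | 4, k => rowMajor (fun i j => ((x i j).den : ℤ)) k
  | _, _ => 0

/-- The length of the binary encoding of a rational number. -/
def ratLen (q : ℚ) : ℕ := bitLen q.num + bitLen q.den

/-- The total binary encoding length of the input `(m, n, p, x)`. -/
def inputSize {m n : ℕ} (p x : Fin m → Fin n → ℚ) : ℕ :=
  bitLen m + bitLen n + ∑ i, ∑ j, (ratLen (p i j) + ratLen (x i j))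

/-- On the input `(m, n, p, x)` the program `c` halts after at most `t` time units, and array `5`
then holds the assignment `σ`, machines being numbered from `0`. -/
def Outputs {m n : ℕ} (c : Prog) (p x : Fin m → Fin n → ℚ) (σ : Fin n → Fin m) (t : ℕ) : Prop :=
  ∃ (M : Mem) (s : ℕ), Exec c (inputMem p x) M s ∧ s ≤ t ∧ ∀ j : Fin n, M 5 (j : ℤ) = (σ j : ℤ)

end MinNorm

/-! Filtering. For a job of positive cost, Markov's inequality bounds by `1/2` the mass that `x`
puts on machines with `p i j > 2 P_j`; dropping it and doubling the rest still covers the job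
(`one_le_sum_filtered`; a job of cost `0` is treated directly). Capping at `1` preserves this.

Rounding, after Shmoys and Tardos. On each machine the jobs are laid on a line by decreasing length,
as consecutive intervals of length the capped filtered value, and the line is cut into unit slots.
The overlaps of jobs with slots are a fractional matching covering every job, so Hall's theorem
gives an integral one (`exists_slots`). For every matching along this graph, a job in slot `s + 1`
is at most as long as the average of slot `s`; only the job in slot `0` is left over, which gives
the load bound (`sum_le_of_meets`).

Norm. The filtered load is at most twice `L`. The longest jobs of different machines are different
jobs, each of length at most `2 P_j`, so their vector is dominated, up to a permutation, by `2 P_S`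
for a set `S` of `m` jobs (`norm_longestJob_le`). The triangle inequality gives `2T + 2T`. The
construction of the assignment uses neither `f` nor `T`.

Algorithm. With common denominators all comparisons are exact integer comparisons. The matching is
found by an auction: since a perfect matching exists, an unassigned job always has an adjacent slot
of price below `n` (`exists_price_lt`), and each bid raises a price by one, so there are at most `m
* n * n` bids. All stored integers have polynomially many bits, and the logic of `Runs` turns these
two bounds into a polynomial running time. -/

namespace MinNorm

/-! ### A program logic with automatic time bounds

A run is controlled by two numbers: `N` bounds the number of iterations of every execution of a
loop, and `W` bounds the absolute values of all memory entries at all times. The running time is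
then at most a polynomial in `N`, which depends only on the program, times the bit length
of `W`. -/

/-- The right side counts two sign bits and the left side one; the spare bit pays for the carry. -/
theorem bitLen_add_le (u v : ℤ) : bitLen (u + v) ≤ bitLen u + bitLen v := by
  have h : (u + v).natAbs.size ≤ u.natAbs.size + v.natAbs.size + 1 := by
    rw [Nat.size_le]
    have hu := Nat.lt_size_self u.natAbs
    have hv := Nat.lt_size_self v.natAbs
    have h1 : 2 ^ u.natAbs.size ≤ 2 ^ (u.natAbs.size + v.natAbs.size) :=
      Nat.pow_le_pow_right (by norm_num) (by omega)
    have h2 : 2 ^ v.natAbs.size ≤ 2 ^ (u.natAbs.size + v.natAbs.size) :=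
      Nat.pow_le_pow_right (by norm_num) (by omega)
    have := Int.natAbs_add_le u v
    rw [pow_succ]
    omega
  simp only [bitLen]
  omega

theorem bitLen_neg (u : ℤ) : bitLen (-u) = bitLen u := by simp [bitLen]

theorem natSize_mul_le (u v : ℕ) : (u * v).size ≤ u.size + v.size := by
  rw [Nat.size_le, pow_add]
  exact Nat.mul_lt_mul'' (Nat.lt_size_self u) (Nat.lt_size_self v)

/-- Lengths are subadditive under every operation, so the length of an expression's value is linear
in the word length, with a factor depending only on the expression. -/
theorem bitLen_op_le (o : Op) (u v : ℤ) : bitLen (o.eval u v) ≤ bitLen u + bitLen v := by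
  cases o with
  | add => exact bitLen_add_le u v
  | sub =>
    have := bitLen_add_le u (-v)
    rwa [bitLen_neg, ← sub_eq_add_neg] at this
  | mul =>
    have := natSize_mul_le u.natAbs v.natAbs
    simp only [Op.eval, bitLen, Int.natAbs_mul]
    omega
  | div =>
    have := Nat.size_le_size (Int.natAbs_ediv_le_natAbs u v)
    simp only [Op.eval, bitLen]
    omega

/-- All entries of the memory have absolute value at most `W`. -/
def Mem.BoundedBy (M : Mem) (W : ℕ) : Prop := ∀ a k, (M a k).natAbs ≤ W

/-- The bit length of the value of an expression is at most its width times the bit length of the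
memory entries. -/
def Expr.width : Expr → ℕ
  | .const c => bitLen c
  | .get _ _ => 1
  | .op _ e₁ e₂ => e₁.width + e₂.width

/-- The cost of an expression is at most its weight times the bit length of the memory entries. -/
def Expr.weight : Expr → ℕ
  | .const c => bitLen c
  | .get _ e => e.weight + e.width + 1
  | .op _ e₁ e₂ => e₁.weight + e₂.weight + e₁.width + e₂.width

theorem Mem.BoundedBy.bitLen_le {M : Mem} {W : ℕ} (hM : M.BoundedBy W) (a : ℕ) (k : ℤ) :
    bitLen (M a k) ≤ W.size + 1 :=
  Nat.succ_le_succ (Nat.size_le_size (hM a k))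

theorem Expr.bitLen_eval_le {M : Mem} {W : ℕ} (hM : M.BoundedBy W) (e : Expr) :
    bitLen (e.eval M) ≤ e.width * (W.size + 1) := by
  induction e with
  | const c => exact Nat.le_mul_of_pos_right _ (Nat.succ_pos _)
  | get a e _ => simpa [Expr.width, Expr.eval] using hM.bitLen_le a (e.eval M)
  | op o e₁ e₂ h₁ h₂ =>
    have := bitLen_op_le o (e₁.eval M) (e₂.eval M)
    simp only [Expr.width, Expr.eval, add_mul]
    omega

theorem Expr.cost_le {M : Mem} {W : ℕ} (hM : M.BoundedBy W) (e : Expr) :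
    e.cost M ≤ e.weight * (W.size + 1) := by
  induction e with
  | const c => exact Nat.le_mul_of_pos_right _ (Nat.succ_pos _)
  | get a e h =>
    have h1 := hM.bitLen_le a (e.eval M)
    have h2 := e.bitLen_eval_le hM
    simp only [Expr.weight, Expr.cost, add_mul, one_mul]
    omega
  | op o e₁ e₂ h₁ h₂ =>
    have h3 := e₁.bitLen_eval_le hM
    have h4 := e₂.bitLen_eval_le hM
    simp only [Expr.weight, Expr.cost, add_mul]
    omega

/-- The running time of a program, in units of the bit length of the memory entries, as a
polynomial in the maximal number of iterations of a loop. -/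
noncomputable def Prog.timeBound : Prog → Polynomial ℕ
  | .skip => 1
  | .assign _ k e => .C (k.weight + e.weight + k.width + e.width)
  | .seq c₁ c₂ => c₁.timeBound + c₂.timeBound
  | .ite e c₁ c₂ => .C (e.weight + 1) + (c₁.timeBound + c₂.timeBound)
  -- The last summand pays for the final test, which fails.
  | .loop e c => .X * (.C (e.weight + 1) + c.timeBound) + .C (e.weight + 1)

/-- The arrays into which a program may write. -/
def Prog.writes : Prog → List ℕ
  | .skip => []
  | .assign a _ _ => [a]
  | .seq c₁ c₂ => c₁.writes ++ c₂.writes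
  | .ite _ c₁ c₂ => c₁.writes ++ c₂.writes
  | .loop _ c => c.writes

theorem Mem.write_apply (M : Mem) (a : ℕ) (k v : ℤ) (b : ℕ) (l : ℤ) :
    M.write a k v b l = if b = a ∧ l = k then v else M b l := by
  unfold Mem.write
  by_cases hb : b = a
  · subst hb
    by_cases hl : l = k <;> simp [hl]
  · simp [hb]

theorem Mem.write_of_ne (M : Mem) (a : ℕ) (k v : ℤ) {b : ℕ} (h : b ≠ a) :
    M.write a k v b = M b := by
  simp [Mem.write, h]

theorem Mem.BoundedBy.write {M : Mem} {W : ℕ} (hM : M.BoundedBy W) (a : ℕ) (k : ℤ) {v : ℤ}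
    (hv : v.natAbs ≤ W) : (M.write a k v).BoundedBy W := by
  intro b l
  rw [Mem.write_apply]
  split_ifs
  · exact hv
  · exact hM b l

/-- For a concrete program the list of written arrays is computed, so that every "unchanged" claim
below reduces to `decide`. -/
theorem Exec.frame {c : Prog} {M M' : Mem} {t : ℕ} (h : Exec c M M' t) :
    ∀ a ∉ c.writes, M' a = M a := by
  induction h with
  | skip M => exact fun _ _ => rfl
  | assign M b k e =>
    intro a ha
    exact M.write_of_ne _ _ _ (by simpa [Prog.writes] using ha)
  | seq _ _ h₁ h₂ =>
    intro a ha
    simp only [Prog.writes, List.mem_append, not_or] at ha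
    rw [h₂ a ha.2, h₁ a ha.1]
  | ite_pos _ _ h =>
    intro a ha
    simp only [Prog.writes, List.mem_append, not_or] at ha
    exact h a ha.1
  | ite_neg _ _ h =>
    intro a ha
    simp only [Prog.writes, List.mem_append, not_or] at ha
    exact h a ha.2
  | loop_done _ => exact fun _ _ => rfl
  | loop_step _ _ _ h₁ h₂ =>
    intro a ha
    rw [h₂ a ha, h₁ a ha]

/-- Started on `M`, the program `c` halts within its time bound in a memory that is bounded
by `W` and satisfies `Q`. -/
def Runs (N W : ℕ) (c : Prog) (M : Mem) (Q : Mem → Prop) : Prop :=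
  ∃ (M' : Mem) (t : ℕ), Exec c M M' t ∧ t ≤ c.timeBound.eval N * (W.size + 1) ∧
    M'.BoundedBy W ∧ Q M'

namespace Runs

variable {N W : ℕ} {M : Mem} {Q : Mem → Prop}

theorem skip (hM : M.BoundedBy W) (hQ : Q M) : Runs N W .skip M Q :=
  ⟨M, 1, .skip M, by simp [Prog.timeBound], hM, hQ⟩

theorem assign {a : ℕ} {k e : Expr} (hM : M.BoundedBy W) (he : (e.eval M).natAbs ≤ W)
    (hQ : Q (M.write a (k.eval M) (e.eval M))) : Runs N W (.assign a k e) M Q := by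
  refine ⟨_, _, .assign M a k e, ?_, hM.write a _ he, hQ⟩
  have h1 := k.bitLen_eval_le hM
  have h2 := e.bitLen_eval_le hM
  have h3 := k.cost_le hM
  have h4 := e.cost_le hM
  simp only [Prog.timeBound, Polynomial.eval_C, add_mul]
  omega

/-- The postcondition of `c₁` is that `c₂` runs correctly, so a proof follows the program from front
to back; the bound on the intermediate memory is handed on for free. -/
theorem seq {c₁ c₂ : Prog}
    (h : Runs N W c₁ M (fun M' => M'.BoundedBy W → Runs N W c₂ M' Q)) :
    Runs N W (.seq c₁ c₂) M Q := by
  obtain ⟨M₁, t₁, e₁, ht₁, hb, h⟩ := h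
  obtain ⟨M₂, t₂, e₂, ht₂, hM₂, hQ⟩ := h hb
  refine ⟨M₂, _, .seq e₁ e₂, ?_, hM₂, hQ⟩
  simp only [Prog.timeBound, Polynomial.eval_add, add_mul]
  omega

theorem ite {e : Expr} {c₁ c₂ : Prog} (hM : M.BoundedBy W)
    (h₁ : 0 < e.eval M → Runs N W c₁ M Q) (h₂ : ¬ 0 < e.eval M → Runs N W c₂ M Q) :
    Runs N W (.ite e c₁ c₂) M Q := by
  have h3 := e.cost_le hM
  by_cases he : 0 < e.eval M
  · obtain ⟨M', t, h, ht, hM', hQ⟩ := h₁ he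
    refine ⟨M', _, .ite_pos he h, ?_, hM', hQ⟩
    simp only [Prog.timeBound, Polynomial.eval_add, Polynomial.eval_C, add_mul]
    omega
  · obtain ⟨M', t, h, ht, hM', hQ⟩ := h₂ he
    refine ⟨M', _, .ite_neg he h, ?_, hM', hQ⟩
    simp only [Prog.timeBound, Polynomial.eval_add, Polynomial.eval_C, add_mul]
    omega

/-- The invariant carries the number `k` of completed iterations. Proving `k < N` whenever the test
succeeds yields termination and the time bound at once. -/
theorem loop {e : Expr} {c : Prog} (J : ℕ → Mem → Prop) (hM : M.BoundedBy W) (h0 : J 0 M)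
    (hstep : ∀ k M', M'.BoundedBy W → J k M' → 0 < e.eval M' →
      k < N ∧ Runs N W c M' (J (k + 1)))
    (hQ : ∀ k M', J k M' → ¬ 0 < e.eval M' → Q M') : Runs N W (.loop e c) M Q := by
  -- Induction on the number `d` of iterations still allowed; for `d = 0` the test must fail, since
  -- success would give `k < N`.
  have key : ∀ d k M, k + d = N → M.BoundedBy W → J k M → ∃ M' t, Exec (.loop e c) M M' t ∧
      t ≤ d * ((e.weight + 1 + c.timeBound.eval N) * (W.size + 1)) +
        (e.weight + 1) * (W.size + 1) ∧ M'.BoundedBy W ∧ Q M' := by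
    intro d
    induction d with
    | zero =>
      intro k M hk hM hJ
      have hc := e.cost_le hM
      have he : ¬ 0 < e.eval M := fun he => by
        have := (hstep k M hM hJ he).1
        omega
      refine ⟨M, _, .loop_done he, ?_, hM, hQ k M hJ he⟩
      have h3 : (e.weight + 1) * (W.size + 1) = e.weight * (W.size + 1) + (W.size + 1) := by ring
      rw [h3]
      exact Nat.le_add_left_of_le (by omega)
    | succ d ih =>
      intro k M hk hM hJ
      have hc := e.cost_le hM
      by_cases he : 0 < e.eval M
      · obtain ⟨M₁, t₁, e₁, ht₁, hb, h⟩ := (hstep k M hM hJ he).2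
        obtain ⟨M₂, t₂, e₂, ht₂, hM₂, hQ⟩ := ih (k + 1) M₁ (by omega) hb h
        refine ⟨M₂, _, .loop_step he e₁ e₂, ?_, hM₂, hQ⟩
        have h3 : (e.weight + 1 + c.timeBound.eval N) * (W.size + 1) = e.weight * (W.size + 1) +
          (W.size + 1) + c.timeBound.eval N * (W.size + 1) := by ring
        rw [Nat.succ_mul]
        omega
      · refine ⟨M, _, .loop_done he, ?_, hM, hQ k M hJ he⟩
        have h3 : (e.weight + 1) * (W.size + 1) = e.weight * (W.size + 1) + (W.size + 1) := by ring
        rw [h3]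
        exact Nat.le_add_left_of_le (by omega)
  obtain ⟨M', t, h, ht, hM', hQ'⟩ := key N 0 M (by omega) hM h0
  refine ⟨M', t, h, ?_, hM', hQ'⟩
  simp only [Prog.timeBound, Polynomial.eval_add, Polynomial.eval_C, Polynomial.eval_mul,
    Polynomial.eval_X]
  rw [add_mul, mul_assoc]
  exact ht

theorem mono {c : Prog} {Q' : Mem → Prop} (h : Runs N W c M Q)
    (hQ : ∀ M', (∀ a ∉ c.writes, M' a = M a) → Q M' → Q' M') : Runs N W c M Q' := by
  obtain ⟨M', t, e, ht, hM', hq⟩ := h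
  exact ⟨M', t, e, ht, hM', hQ M' e.frame hq⟩

end Runs

/-! ### Notation for programs -/

instance : Add Expr := ⟨.op .add⟩
instance : Sub Expr := ⟨.op .sub⟩
instance : Mul Expr := ⟨.op .mul⟩
instance : Div Expr := ⟨.op .div⟩
instance (k : ℕ) : OfNat Expr k := ⟨.const k⟩

@[simp] theorem Expr.eval_add (M : Mem) (e e' : Expr) :
    (e + e').eval M = e.eval M + e'.eval M := rfl
@[simp] theorem Expr.eval_sub (M : Mem) (e e' : Expr) :
    (e - e').eval M = e.eval M - e'.eval M := rfl
@[simp] theorem Expr.eval_mul (M : Mem) (e e' : Expr) :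
    (e * e').eval M = e.eval M * e'.eval M := rfl
@[simp] theorem Expr.eval_div (M : Mem) (e e' : Expr) :
    (e / e').eval M = e.eval M / e'.eval M := rfl
@[simp] theorem Expr.eval_zero (M : Mem) : (0 : Expr).eval M = 0 := rfl
@[simp] theorem Expr.eval_one (M : Mem) : (1 : Expr).eval M = 1 := rfl
@[simp] theorem Expr.eval_two (M : Mem) : (2 : Expr).eval M = 2 := rfl
@[simp] theorem Expr.eval_get (M : Mem) (a : ℕ) (e : Expr) :
    (Expr.get a e).eval M = M a (e.eval M) := rfl

/-- The variable `a`, which is the entry with index `0` of the array `a`. -/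
abbrev Expr.var (a : ℕ) : Expr := .get a 0

/-- `e mod e'`. -/
def Expr.mod (e e' : Expr) : Expr := e - e / e' * e'

@[simp] theorem Expr.eval_mod (M : Mem) (e e' : Expr) :
    (e.mod e').eval M = e.eval M % e'.eval M := by
  simp [Expr.mod, Int.emod_def, mul_comm]

/-- `for v = 0, …, b - 1 do c`. -/
def Prog.forLoop (v : ℕ) (b : Expr) (c : Prog) : Prog :=
  .seq (.assign v 0 0) (.loop (b - .var v) (.seq c (.assign v 0 (.var v + 1))))

/-- The memories that differ from `M` only in `v` and in the arrays that `c` writes. -/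
def Mem.Frame (v : ℕ) (c : Prog) (M M' : Mem) : Prop :=
  ∀ a, a ≠ v → a ∉ c.writes → M' a = M a

/-- The loop owns its counter: the body does not write it and the invariant does not see it (`hI`),
so initialising and incrementing preserve `I`. The upper limit `b` is evaluated again at each test,
hence `hb` along the whole frame; the counter reaches `n`, hence `n ≤ W`. -/
theorem Runs.forLoop {N W v n : ℕ} {b : Expr} {c : Prog} {M : Mem} {Q : Mem → Prop}
    (I : ℕ → Mem → Prop) (hN : n ≤ N) (hW : n ≤ W) (hM : M.BoundedBy W) (hv : v ∉ c.writes)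
    (hb : ∀ M', Mem.Frame v c M M' → b.eval M' = n)
    (hI : ∀ k M' w, I k M' → I k (M'.write v 0 w))
    (h0 : I 0 M)
    (hstep : ∀ k < n, ∀ M', M'.BoundedBy W → Mem.Frame v c M M' → M' v 0 = k → I k M' →
      Runs N W c M' (I (k + 1)))
    (hQ : ∀ M', M'.BoundedBy W → Mem.Frame v c M M' → I n M' → Q M') :
    Runs N W (.forLoop v b c) M Q := by
  refine .seq (.assign hM (by simp) fun hM₁ => ?_)
  refine .loop (fun k M' => M'.BoundedBy W ∧ Mem.Frame v c M M' ∧ M' v 0 = k ∧ k ≤ n ∧ I k M')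
    hM₁ ⟨hM₁, ?_, ?_, Nat.zero_le _, hI _ _ _ h0⟩ ?_ ?_
  · intro a ha _
    exact M.write_of_ne _ _ _ ha
  · simp [Mem.write_apply]
  · rintro k M' hM' ⟨-, hf, hk, hkn, hIk⟩ he
    have hkn' : k < n := by
      simp only [Expr.eval_sub, Expr.eval_get, Expr.eval_zero, hb M' hf, hk] at he
      omega
    refine ⟨by omega, .seq (.mono (hstep k hkn' M' hM' hf hk hIk) ?_)⟩
    intro M₂ hf₂ hI₂ hM₂
    have hk₂ : M₂ v 0 = k := by rw [hf₂ v hv, hk]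
    have hval : (Expr.var v + 1).eval M₂ = ((k + 1 : ℕ) : ℤ) := by simp [hk₂]
    have hle : ((Expr.var v + 1).eval M₂).natAbs ≤ W := by
      rw [hval]
      omega
    refine .assign hM₂ hle ⟨hM₂.write _ _ hle, ?_, ?_, hkn', hI _ _ _ hI₂⟩
    · intro a ha ha'
      rw [Mem.write_of_ne _ _ _ _ ha, hf₂ a ha', hf a ha ha']
    · rw [hval]
      simp [Mem.write_apply]
  · rintro k M' ⟨hM', hf, hk, hkn, hIk⟩ he
    simp only [Expr.eval_sub, Expr.eval_get, Expr.eval_zero, hb M' hf, hk] at he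
    obtain rfl : k = n := by omega
    exact hQ M' hM' hf hIk

end MinNorm

namespace MinNorm

/-! ### Bipartite matching by auction

Jobs and slots are numbered from `0`. An unassigned job takes a cheapest slot adjacent to it,
raises the price of this slot by `1`, and evicts the former owner of the slot, if there is one.
An owner `j + 1` of a slot stands for the job `j`, an owner `0` for an empty slot. -/

/-- The invariant of the auction: the jobs below `J` have been treated, all of them have a slot
except for the job `j` with `cur = j + 1`. -/
structure AuctionState (Adj : ℕ → ℕ → Prop) (n Q J cur : ℕ) (owner price : ℕ → ℕ) : Prop where
  cur_le : cur ≤ J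
  owner_le : ∀ q < Q, owner q ≤ J
  owner_inj : ∀ q < Q, ∀ q' < Q, owner q = owner q' → owner q ≠ 0 → q = q'
  cur_ne : cur ≠ 0 → ∀ q < Q, owner q ≠ cur
  assigned : ∀ j < J, j + 1 = cur ∨ ∃ q < Q, owner q = j + 1
  adj : ∀ q < Q, ∀ j, owner q = j + 1 → Adj j q
  cheap : ∀ q < Q, ∀ j, owner q = j + 1 → ∀ q' < Q, Adj j q' → price q ≤ price q' + 1
  occupied : ∀ q < Q, 0 < price q → owner q ≠ 0
  price_le : ∀ q < Q, price q ≤ n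

namespace AuctionState

variable {Adj : ℕ → ℕ → Prop} {n Q J cur : ℕ} {owner price : ℕ → ℕ}

/-- If all jobs can be matched, then the unassigned job has an adjacent slot of price less
than `n`. -/
theorem exists_price_lt {j : ℕ} (h : AuctionState Adj n Q J (j + 1) owner price) (hJ : J ≤ n)
    {μ : ℕ → ℕ} (hμ : ∀ j < n, μ j < Q ∧ Adj j (μ j)) (hinj : Set.InjOn μ (Set.Iio n)) :
    ∃ q < Q, Adj j q ∧ price q < n := by
  by_contra! hc
  -- An alternating walk: from a job to its slot under `μ`, then to the owner of that slot. If all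
  -- slots adjacent to `j` cost at least `n`, then by `cheap` those adjacent to the `t`-th job cost
  -- at least `n - t`. Before step `n` they are thus occupied, and the walk goes on.
  let f : ℕ → ℕ := fun t => Nat.rec j (fun _ l => owner (μ l) - 1) t
  have hf : ∀ t, f (t + 1) = owner (μ (f t)) - 1 := fun _ => rfl
  have key : ∀ t ≤ n, f t < J ∧ ∀ q < Q, Adj (f t) q → n ≤ price q + t := by
    intro t
    induction t with
    | zero => exact fun _ => ⟨h.cur_le, hc⟩
    | succ t ih =>
      intro ht
      obtain ⟨h1, h2⟩ := ih (by omega)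
      obtain ⟨h3, h4⟩ := hμ (f t) (by omega)
      have h5 := h2 _ h3 h4
      have h6 := h.occupied _ h3 (by omega)
      have h7 := h.owner_le _ h3
      have h8 : owner (μ (f t)) = f (t + 1) + 1 := by
        rw [hf]
        omega
      refine ⟨by omega, fun q hq hadj => ?_⟩
      have := h.cheap _ h3 _ h8 q hq hadj
      omega
  have hsucc : ∀ t < n, owner (μ (f t)) = f (t + 1) + 1 := by
    intro t ht
    obtain ⟨h1, h2⟩ := key t ht.le
    obtain ⟨h3, h4⟩ := hμ (f t) (by omega)
    have h5 := h2 _ h3 h4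
    have h6 := h.occupied _ h3 (by omega)
    rw [hf]
    omega
  -- `μ` and ownership are injective, so a repetition could be traced back to the start; but `j`
  -- owns no slot. The walk then visits `n + 1` different jobs among fewer than `n + 1`.
  have hne : ∀ s t, s < t → t ≤ n → f s ≠ f t := by
    intro s
    induction s with
    | zero =>
      intro t hst ht heq
      obtain ⟨t, rfl⟩ := Nat.exists_eq_succ_of_ne_zero hst.ne'
      refine h.cur_ne (Nat.succ_ne_zero j) (μ (f t)) (hμ _ ?_).1 ?_
      · have := (key t (by omega)).1
        omega
      · rw [hsucc t (by omega)]
        exact congrArg (· + 1) heq.symm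
    | succ s ih =>
      intro t hst ht heq
      obtain ⟨t, rfl⟩ := Nat.exists_eq_succ_of_ne_zero (by omega : t ≠ 0)
      have h1 := (key s (by omega)).1
      have h2 := (key t (by omega)).1
      have h3 := hsucc s (by omega)
      have h4 := hsucc t (by omega)
      have h5 : μ (f s) = μ (f t) :=
        h.owner_inj _ (hμ _ (by omega)).1 _ (hμ _ (by omega)).1 (by rw [h3, h4, heq])
          (by omega)
      exact ih t (by omega) (by omega)
        (hinj (Set.mem_Iio.2 (by omega)) (Set.mem_Iio.2 (by omega)) h5)
  have hcard : (Finset.range (n + 1)).card ≤ (Finset.range n).card := by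
    refine Finset.card_le_card_of_injOn f ?_ ?_
    · intro t ht
      have ht' := Finset.mem_range.1 (Finset.mem_coe.1 ht)
      have := (key t (by omega)).1
      simp only [Finset.coe_range, Set.mem_Iio]
      omega
    · intro s hs t ht heq
      simp only [Finset.coe_range, Set.mem_Iio] at hs ht
      rcases lt_trichotomy s t with h1 | h1 | h1
      · exact absurd heq (hne s t h1 (by omega))
      · exact h1
      · exact absurd heq.symm (hne t s h1 (by omega))
  simp at hcard

/-- The unassigned job takes a cheapest slot. -/
theorem step {j q : ℕ} (h : AuctionState Adj n Q J (j + 1) owner price) (hq : q < Q)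
    (hadj : Adj j q) (hlt : price q < n)
    (hmin : ∀ q' < Q, Adj j q' → price q ≤ price q') :
    AuctionState Adj n Q J (owner q) (Function.update owner q (j + 1))
      (Function.update price q (price q + 1)) := by
  have hle : ∀ q', price q' ≤ Function.update price q (price q + 1) q' := by
    intro q'
    by_cases hq' : q' = q
    · subst hq'
      simp
    · simp [hq']
  constructor
  · exact h.owner_le q hq
  · intro q' hq'
    by_cases hqq : q' = q
    · simpa [hqq] using h.cur_le
    · simpa [hqq] using h.owner_le q' hq'
  · intro q₁ h₁ q₂ h₂ heq hne
    have hcn := h.cur_ne (Nat.succ_ne_zero j)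
    by_cases e₁ : q₁ = q <;> by_cases e₂ : q₂ = q
    · rw [e₁, e₂]
    · simp only [e₁, Function.update_self, e₂, ne_eq, not_false_eq_true,
        Function.update_of_ne] at heq
      exact absurd heq.symm (hcn q₂ h₂)
    · simp only [e₂, Function.update_self, e₁, ne_eq, not_false_eq_true,
        Function.update_of_ne] at heq
      exact absurd heq (hcn q₁ h₁)
    · simp only [e₂, e₁, ne_eq, not_false_eq_true, Function.update_of_ne] at heq hne
      exact h.owner_inj q₁ h₁ q₂ h₂ heq hne
  · intro hne q' hq' heq
    by_cases hqq : q' = q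
    · simp only [hqq, Function.update_self] at heq
      exact h.cur_ne (Nat.succ_ne_zero j) q hq heq.symm
    · simp only [ne_eq, hqq, not_false_eq_true, Function.update_of_ne] at heq
      exact hqq (h.owner_inj q' hq' q hq heq (by rwa [heq]))
  · intro l hl
    rcases h.assigned l hl with h1 | ⟨q', hq', h1⟩
    · exact .inr ⟨q, hq, by simpa using h1.symm⟩
    · by_cases hqq : q' = q
      -- The evicted owner of `q` is the new unassigned job.
      · exact .inl (by rw [← h1, hqq])
      · exact .inr ⟨q', hq', by simpa [hqq] using h1⟩
  · intro q' hq' l hl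
    by_cases hqq : q' = q
    · simp only [hqq, Function.update_self, Nat.add_right_cancel_iff] at hl
      rwa [hqq, ← hl]
    · simp only [ne_eq, hqq, not_false_eq_true, Function.update_of_ne] at hl
      exact h.adj q' hq' l hl
  · intro q' hq' l hl q₂ h₂ ha
    -- Prices only grow, so it suffices to compare with the old price of `q₂`. For the new owner
    -- this is the minimality of `q`; for the other owners their own price is unchanged.
    refine le_trans ?_ (Nat.succ_le_succ (hle q₂))
    by_cases hqq : q' = q
    · simp only [hqq, Function.update_self, Nat.add_right_cancel_iff] at hl ⊢
      rw [← hl] at ha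
      exact Nat.succ_le_succ (hmin q₂ h₂ ha)
    · simp only [ne_eq, hqq, not_false_eq_true, Function.update_of_ne] at hl ⊢
      exact h.cheap q' hq' l hl q₂ h₂ ha
  · intro q' hq' hpos
    by_cases hqq : q' = q
    · simp [hqq]
    · simp only [ne_eq, hqq, not_false_eq_true, Function.update_of_ne] at hpos ⊢
      exact h.occupied q' hq' hpos
  · intro q' hq'
    by_cases hqq : q' = q
    · simpa [hqq] using hlt
    · simpa [hqq] using h.price_le q' hq'

/-- A new job enters the auction. -/
theorem next (h : AuctionState Adj n Q J 0 owner price) :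
    AuctionState Adj n Q (J + 1) (J + 1) owner price where
  cur_le := le_rfl
  owner_le q hq := (h.owner_le q hq).trans (Nat.le_succ J)
  owner_inj := h.owner_inj
  cur_ne _ q hq := by
    have := h.owner_le q hq
    omega
  assigned j hj := by
    rcases Nat.lt_succ_iff_lt_or_eq.1 hj with h1 | h1
    · rcases h.assigned j h1 with h2 | h2
      · omega
      · exact .inr h2
    · exact .inl (by rw [h1])
  adj := h.adj
  cheap := h.cheap
  occupied := h.occupied
  price_le := h.price_le

theorem init : AuctionState Adj n Q 0 0 (fun _ => 0) (fun _ => 0) := by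
  constructor <;> simp

/-- The sum of all prices is the potential that counts bids: it grows by one with each bid and stays
below `Q * n` as long as a bid below `n` is possible. -/
theorem sum_price_lt (h : AuctionState Adj n Q J cur owner price) {q : ℕ} (hq : q < Q)
    (hlt : price q < n) : ∑ q ∈ Finset.range Q, price q < Q * n := by
  calc ∑ q ∈ Finset.range Q, price q < ∑ q ∈ Finset.range Q, n :=
        Finset.sum_lt_sum (fun q hq => h.price_le q (Finset.mem_range.1 hq))
          ⟨q, Finset.mem_range.2 hq, hlt⟩
    _ = Q * n := by simp

end AuctionState

end MinNorm

namespace MinNorm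

open Finset

/-! ### The rounding program -/

/-- The input of the rounding program: two `m × n` tables of fractions stored row by row. -/
structure Tables where
  m : ℕ
  n : ℕ
  pNum : ℕ → ℤ
  pDen : ℕ → ℤ
  xNum : ℕ → ℤ
  xDen : ℕ → ℤ

namespace Tables

variable (d : Tables)

/-- A common denominator of the processing times. -/
def pScale : ℤ := ∏ k ∈ range (d.m * d.n), d.pDen k

/-- A common denominator of the fractional assignment. -/
def xScale : ℤ := ∏ k ∈ range (d.m * d.n), d.xDen k

/-- The scaled processing times. -/
def proc (k : ℕ) : ℤ := d.pNum k * (d.pScale / d.pDen k)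

/-- The scaled fractional assignment. -/
def frac (k : ℕ) : ℤ := d.xNum k * (d.xScale / d.xDen k)

/-- The scaled cost of a job. -/
def cost (j : ℕ) : ℤ := ∑ i ∈ range d.m, d.proc (i * d.n + j) * d.frac (i * d.n + j)

/-- The scaled filtered solution, capped at `1`. -/
def capped (k : ℕ) : ℤ :=
  -- Tests are strict, so `+ 1` expresses `≤` between integers: this is `p ≤ 2P`, scaled by both
  -- common denominators.
  if 0 < 2 * d.cost (k % d.n) - d.proc k * d.xScale + 1 then
    if 0 < 2 * d.frac k - d.xScale then d.xScale else 2 * d.frac k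
  else 0

/-- The contribution of column `j` to the position of entry `k` in its row. -/
def shift (k j : ℕ) : ℤ :=
  -- A lexicographic comparison in one integer: the index difference is below `n` in absolute value,
  -- so it matters only for equal lengths. Longer jobs come first, then smaller indices.
  if 0 < (d.proc (k / d.n * d.n + j) - d.proc k) * d.n + (((k % d.n : ℕ) : ℤ) - j) then
    d.capped (k / d.n * d.n + j) else 0

/-- The scaled position of an entry in its row. -/
def pos (k : ℕ) : ℤ := ∑ j ∈ range d.n, d.shift k j

/-- Job `j` is adjacent to slot `q` if the interval of the job meets that of the slot. -/
def Adj (j q : ℕ) : Prop :=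
  -- Slot `q` is slot `q % n` of machine `q / n`; with values capped at `1`, `n` slots per machine
  -- hold everything.
  0 < d.capped (q / d.n * d.n + j) ∧
  0 < (((q % d.n : ℕ) : ℤ) + 1) * d.xScale - d.pos (q / d.n * d.n + j) ∧
  0 < d.pos (q / d.n * d.n + j) + d.capped (q / d.n * d.n + j) - ((q % d.n : ℕ) : ℤ) * d.xScale

/-- All numbers that occur in the computation are bounded by `W`. -/
structure BoundedBy (W : ℕ) : Prop where
  -- Products and sums are accumulated in memory, so all partial results have to be bounded.
  pScale : ∀ k ≤ d.m * d.n, (∏ l ∈ range k, d.pDen l).natAbs ≤ W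
  xScale : ∀ k ≤ d.m * d.n, (∏ l ∈ range k, d.xDen l).natAbs ≤ W
  cost : ∀ j < d.n, ∀ k ≤ d.m,
    (∑ i ∈ range k, d.proc (i * d.n + j) * d.frac (i * d.n + j)).natAbs ≤ W
  capped : ∀ k < d.m * d.n, (d.capped k).natAbs ≤ W
  pos : ∀ k < d.m * d.n, ∀ l ≤ d.n, (∑ j ∈ range l, d.shift k j).natAbs ≤ W
  rows : d.m ≤ W
  cols : d.n ≤ W
  cells : d.m * d.n ≤ W

/-- The arrays `0` to `4` of the memory hold the tables. -/
structure HeldBy (M : Mem) : Prop where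
  m : M 0 0 = d.m
  n : M 0 1 = d.n
  pNum : ∀ k : ℕ, M 1 k = d.pNum k
  pDen : ∀ k : ℕ, M 2 k = d.pDen k
  xNum : ∀ k : ℕ, M 3 k = d.xNum k
  xDen : ∀ k : ℕ, M 4 k = d.xDen k

variable {d}

theorem HeldBy.congr {M M' : Mem} (h : d.HeldBy M) (hM : ∀ a < 5, M' a = M a) : d.HeldBy M' := by
  constructor
  · rw [hM 0 (by norm_num), h.m]
  · rw [hM 0 (by norm_num), h.n]
  · rw [hM 1 (by norm_num)]; exact h.pNum
  · rw [hM 2 (by norm_num)]; exact h.pDen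
  · rw [hM 3 (by norm_num)]; exact h.xNum
  · rw [hM 4 (by norm_num)]; exact h.xDen

end Tables

/-- The number of machines. -/
abbrev mExpr : Expr := .get 0 0
/-- The number of jobs. -/
abbrev nExpr : Expr := .get 0 1
/-- The scaled processing time with index `k`; the common denominator is in array `6`. -/
def procExpr (k : Expr) : Expr := .get 1 k * (.var 6 / .get 2 k)
/-- The scaled fraction with index `k`; the common denominator is in array `7`. -/
def fracExpr (k : Expr) : Expr := .get 3 k * (.var 7 / .get 4 k)

/-- Computes the common denominators. -/
def scaleProg : Prog :=
  .seq (.assign 6 0 1) (.seq (.assign 7 0 1) (.forLoop 17 (mExpr * nExpr)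
    (.seq (.assign 6 0 (.var 6 * .get 2 (.var 17))) (.assign 7 0 (.var 7 * .get 4 (.var 17))))))

/-- Adds an entry to the cost of a job. -/
def costBody : Prog :=
  .assign 8 (.var 18) (.get 8 (.var 18) +
    procExpr (.var 16 * nExpr + .var 18) * fracExpr (.var 16 * nExpr + .var 18))

/-- Computes the scaled job costs in array `8`. -/
def costProg : Prog := .forLoop 18 nExpr (.forLoop 16 mExpr costBody)

/-- Computes an entry of the capped filtered solution. -/
def cappedBody : Prog :=
  .ite (2 * .get 8 (Expr.mod (.var 17) nExpr) - procExpr (.var 17) * .var 7 + 1)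
    (.ite (2 * fracExpr (.var 17) - .var 7)
      (.assign 9 (.var 17) (.var 7)) (.assign 9 (.var 17) (2 * fracExpr (.var 17))))
    .skip

/-- Computes the capped filtered solution in array `9`. -/
def cappedProg : Prog := .forLoop 17 (mExpr * nExpr) cappedBody

/-- Adds an entry to the position of another entry of the same row. -/
def posBody : Prog :=
  .ite ((procExpr (.var 17 / nExpr * nExpr + .var 18) - procExpr (.var 17)) * nExpr +
      (Expr.mod (.var 17) nExpr - .var 18))
    (.assign 10 (.var 17) (.get 10 (.var 17) + .get 9 (.var 17 / nExpr * nExpr + .var 18)))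
    .skip

/-- Computes the positions in array `10`. -/
def posProg : Prog := .forLoop 17 (mExpr * nExpr) (.forLoop 18 nExpr posBody)

/-- The index of the entry of the current job in the row of the current slot. -/
def entryExpr : Expr := .var 19 / nExpr * nExpr + (.var 13 - 1)

/-- Compares the current slot with the best slot found so far. -/
def searchBody : Prog :=
  .ite (.get 9 entryExpr)
    (.ite ((Expr.mod (.var 19) nExpr + 1) * .var 7 - .get 10 entryExpr)
      (.ite (.get 10 entryExpr + .get 9 entryExpr - Expr.mod (.var 19) nExpr * .var 7)
        (.ite (.var 15 - .get 12 (.var 19))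
          (.seq (.assign 15 0 (.get 12 (.var 19))) (.assign 14 0 (.var 19)))
          .skip)
        .skip)
      .skip)
    .skip

/-- Finds a cheapest slot adjacent to the current job. -/
def searchProg : Prog :=
  -- The price `n` plays the role of infinity: some adjacent slot is always cheaper.
  .seq (.assign 15 0 nExpr) (.forLoop 19 (mExpr * nExpr) searchBody)

/-- The current job takes the slot found and becomes the former owner of the slot. -/
def takeProg : Prog :=
  -- The output is kept up to date during the auction; the entry of an evicted job is stale until
  -- that job bids again.
  .seq (.assign 5 (.var 13 - 1) (.var 14 / nExpr))
    (.seq (.assign 20 0 (.get 11 (.var 14)))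
      (.seq (.assign 11 (.var 14) (.var 13))
        (.seq (.assign 12 (.var 14) (.get 12 (.var 14) + 1))
          (.assign 13 0 (.var 20)))))

/-- Matches the jobs to slots. -/
def matchProg : Prog :=
  .forLoop 18 nExpr (.seq (.assign 13 0 (.var 18 + 1))
    (.loop (.var 13) (.seq searchProg takeProg)))

/-- The rounding program. -/
def roundProg : Prog :=
  .seq scaleProg (.seq costProg (.seq cappedProg (.seq posProg matchProg)))

/-! ### Correctness of the phases that build the slot graph -/

variable {d : Tables} {N W : ℕ} {M : Mem}

theorem Tables.HeldBy.eval_procExpr (h : d.HeldBy M) (h6 : M 6 0 = d.pScale) {e : Expr} {k : ℕ}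
    (he : e.eval M = k) : (procExpr e).eval M = d.proc k := by
  simp [procExpr, he, h.pNum, h.pDen, h6, Tables.proc]

theorem Tables.HeldBy.eval_fracExpr (h : d.HeldBy M) (h7 : M 7 0 = d.xScale) {e : Expr} {k : ℕ}
    (he : e.eval M = k) : (fracExpr e).eval M = d.frac k := by
  simp [fracExpr, he, h.xNum, h.xDen, h7, Tables.frac]

theorem runs_scaleProg (hW : d.BoundedBy W) (hN : d.m * d.n ≤ N) (hM : M.BoundedBy W)
    (h : d.HeldBy M) :
    Runs N W scaleProg M (fun M' => M' 6 0 = d.pScale ∧ M' 7 0 = d.xScale) := by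
  -- The empty partial product is `1`.
  have hW1 : 1 ≤ W := by simpa using hW.pScale 0 (Nat.zero_le _)
  refine .seq (.assign hM (by simpa using hW1) fun hM₁ => ?_)
  refine .seq (.assign hM₁ (by simpa using hW1) fun hM₂ => ?_)
  refine .forLoop (fun k M' => M' 6 0 = ∏ l ∈ range k, d.pDen l ∧
    M' 7 0 = ∏ l ∈ range k, d.xDen l) hN hW.cells hM₂ (by decide) ?_ ?_ ?_ ?_ ?_
  · intro M' hf
    have h0 : M' 0 = M 0 := by
      rw [hf 0 (by decide) (by decide), Mem.write_of_ne _ _ _ _ (by decide),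
        Mem.write_of_ne _ _ _ _ (by decide)]
    simp [h0, h.m, h.n]
  · simp [Mem.write_apply]
  · simp [Mem.write_apply]
  · rintro k hk M' hM' hf h17 ⟨h6, h7⟩
    have h' : d.HeldBy M' := h.congr fun a ha => by
      rw [hf a (by omega) (by
        simp only [Prog.writes, List.cons_append, List.nil_append, List.mem_cons,
          List.not_mem_nil, or_false]
        omega), Mem.write_of_ne _ _ _ _ (by omega), Mem.write_of_ne _ _ _ _ (by omega)]
    have e6 := prod_range_succ d.pDen k
    have e7 := prod_range_succ d.xDen k
    refine .seq (.assign hM' ?_ fun hM₃ => .assign hM₃ ?_ ?_)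
    · simpa [h17, h6, h'.pDen, ← e6] using hW.pScale (k + 1) hk
    · simpa [Mem.write_apply, h17, h7, h'.xDen, ← e7] using hW.xScale (k + 1) hk
    · simp [Mem.write_apply, h17, h6, h7, h'.pDen, h'.xDen, ← e6, ← e7]
  · exact fun M' _ _ h => h

theorem runs_costProg (hW : d.BoundedBy W) (hNm : d.m ≤ N) (hNn : d.n ≤ N) (hM : M.BoundedBy W)
    (h : d.HeldBy M) (h6 : M 6 0 = d.pScale) (h7 : M 7 0 = d.xScale)
    (h8 : ∀ j : ℕ, M 8 j = 0) :
    Runs N W costProg M (fun M' => ∀ j < d.n, M' 8 (j : ℕ) = d.cost j) := by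
  refine .forLoop (fun j M' => ∀ l : ℕ, M' 8 l = if l < j then d.cost l else 0) hNn hW.cols hM
    (by decide) ?_ ?_ ?_ ?_ ?_
  · intro M' hf
    simp [hf 0 (by decide) (by decide), h.n]
  · simp [Mem.write_apply]
  · simpa using h8
  · intro j hj M₁ hM₁ hf₁ h18 hI
    have h₁ : d.HeldBy M₁ := h.congr fun a ha => hf₁ a (by omega) (by
      interval_cases a <;> decide)
    refine .forLoop (fun i M' => ∀ l : ℕ, M' 8 l = if l < j then d.cost l else if l = j then
      ∑ i ∈ range i, d.proc (i * d.n + j) * d.frac (i * d.n + j) else 0) hNm hW.rows hM₁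
      (by decide) ?_ ?_ ?_ ?_ ?_
    · intro M' hf
      simp [hf 0 (by decide) (by decide), h₁.m]
    · simp [Mem.write_apply]
    · intro l
      simp [hI l]
    · intro i hi M₂ hM₂ hf₂ h16 hI₂
      have h₂ : d.HeldBy M₂ := h₁.congr fun a ha => hf₂ a (by omega) (by
        interval_cases a <;> decide)
      have e18 : M₂ 18 0 = j := by rw [hf₂ 18 (by decide) (by decide), h18]
      have e6 : M₂ 6 0 = d.pScale := by
        rw [hf₂ 6 (by decide) (by decide), hf₁ 6 (by decide) (by decide), h6]
      have e7 : M₂ 7 0 = d.xScale := by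
        rw [hf₂ 7 (by decide) (by decide), hf₁ 7 (by decide) (by decide), h7]
      have ek : (Expr.var 16 * nExpr + .var 18).eval M₂ = ((i * d.n + j : ℕ) : ℤ) := by
        simp [h16, h₂.n, e18]
      have es := sum_range_succ (fun i => d.proc (i * d.n + j) * d.frac (i * d.n + j)) i
      have ev : (Expr.get 8 (.var 18) + procExpr (.var 16 * nExpr + .var 18) *
          fracExpr (.var 16 * nExpr + .var 18)).eval M₂ =
          ∑ i ∈ range (i + 1), d.proc (i * d.n + j) * d.frac (i * d.n + j) := by
        rw [Expr.eval_add, Expr.eval_mul, h₂.eval_procExpr e6 ek, h₂.eval_fracExpr e7 ek, es]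
        simp [e18, hI₂ j]
      refine .assign hM₂ ?_ ?_
      · rw [ev]
        exact hW.cost j hj (i + 1) hi
      · intro l
        rw [ev]
        simp only [Mem.write_apply, Expr.eval_get, Expr.eval_zero, e18, Nat.cast_inj, true_and]
        rw [hI₂ l]
        grind
    · intro M' _ _ hI' l
      rw [hI' l]
      grind [Tables.cost]
  · intro M' _ _ hI j hj
    simp [hI j, hj]

theorem runs_cappedProg (hW : d.BoundedBy W) (hN : d.m * d.n ≤ N) (hM : M.BoundedBy W)
    (h : d.HeldBy M) (h6 : M 6 0 = d.pScale) (h7 : M 7 0 = d.xScale)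
    (h8 : ∀ j < d.n, M 8 (j : ℕ) = d.cost j) (h9 : ∀ k : ℕ, M 9 k = 0) :
    Runs N W cappedProg M (fun M' => ∀ k < d.m * d.n, M' 9 (k : ℕ) = d.capped k) := by
  refine .forLoop (fun k M' => ∀ l : ℕ, M' 9 l = if l < k then d.capped l else 0) hN hW.cells hM
    (by decide) ?_ ?_ ?_ ?_ ?_
  · intro M' hf
    simp [hf 0 (by decide) (by decide), h.m, h.n]
  · simp [Mem.write_apply]
  · simpa using h9
  · intro k hk M₁ hM₁ hf₁ h17 hI
    have hn : 0 < d.n := Nat.pos_of_mul_pos_left (by omega : 0 < d.m * d.n)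
    have h₁ : d.HeldBy M₁ := h.congr fun a ha => hf₁ a (by omega) (by
      interval_cases a <;> decide)
    have e6 : M₁ 6 0 = d.pScale := by rw [hf₁ 6 (by decide) (by decide), h6]
    have e7 : M₁ 7 0 = d.xScale := by rw [hf₁ 7 (by decide) (by decide), h7]
    have ek : (Expr.var 17).eval M₁ = (k : ℤ) := by simp [h17]
    have e8 : M₁ 8 ((k : ℤ) % d.n) = d.cost (k % d.n) := by
      rw [hf₁ 8 (by decide) (by decide), ← h8 _ (Nat.mod_lt _ hn), Int.natCast_mod]
    have ep := h₁.eval_procExpr e6 ek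
    have ex := h₁.eval_fracExpr e7 ek
    have hcap := hW.capped k hk
    have hw : ∀ v, v = d.capped k → ∀ l : ℕ, M₁.write 9 (M₁ 17 0) v 9 l =
        if l < k + 1 then d.capped l else 0 := by
      rintro _ rfl l
      simp only [Mem.write_apply, h17, Nat.cast_inj, true_and, hI l]
      grind
    have t1 : (2 * Expr.get 8 (Expr.mod (.var 17) nExpr) - procExpr (.var 17) * .var 7 + 1).eval
        M₁ = 2 * d.cost (k % d.n) - d.proc k * d.xScale + 1 := by
      simp [ep, h17, h₁.n, e8, e7]
    have t2 : (2 * fracExpr (.var 17) - .var 7).eval M₁ = 2 * d.frac k - d.xScale := by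
      simp [ex, e7]
    refine .ite hM₁ (fun c1 => .ite hM₁ (fun c2 => ?_) fun c2 => ?_) fun c1 => ?_
    all_goals rw [t1] at c1
    all_goals try rw [t2] at c2
    · have hv : (Expr.var 7).eval M₁ = d.capped k := by
        rw [Tables.capped, if_pos c1, if_pos c2]
        simp [e7]
      exact .assign hM₁ (by rwa [hv]) (hw _ hv)
    · have hv : (2 * fracExpr (.var 17)).eval M₁ = d.capped k := by
        rw [Tables.capped, if_pos c1, if_neg c2]
        simp [ex]
      exact .assign hM₁ (by rwa [hv]) (hw _ hv)
    · refine .skip hM₁ fun l => ?_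
      have hv : d.capped k = 0 := by rw [Tables.capped, if_neg c1]
      rw [hI l]
      grind
  · intro M' _ _ hI k hk
    simp [hI k, hk]

theorem runs_posProg (hW : d.BoundedBy W) (hN : d.m * d.n ≤ N) (hNn : d.n ≤ N)
    (hM : M.BoundedBy W) (h : d.HeldBy M) (h6 : M 6 0 = d.pScale)
    (h9 : ∀ k < d.m * d.n, M 9 (k : ℕ) = d.capped k) (h10 : ∀ k : ℕ, M 10 k = 0) :
    Runs N W posProg M (fun M' => ∀ k < d.m * d.n, M' 10 (k : ℕ) = d.pos k) := by
  refine .forLoop (fun k M' => ∀ l : ℕ, M' 10 l = if l < k then d.pos l else 0) hN hW.cells hM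
    (by decide) ?_ ?_ ?_ ?_ ?_
  · intro M' hf
    simp [hf 0 (by decide) (by decide), h.m, h.n]
  · simp [Mem.write_apply]
  · simpa using h10
  · intro k hk M₁ hM₁ hf₁ h17 hI
    have hn : 0 < d.n := Nat.pos_of_mul_pos_left (by omega : 0 < d.m * d.n)
    have h₁ : d.HeldBy M₁ := h.congr fun a ha => hf₁ a (by omega) (by
      interval_cases a <;> decide)
    refine .forLoop (fun j M' => ∀ l : ℕ, M' 10 l = if l < k then d.pos l else if l = k then
      ∑ j ∈ range j, d.shift k j else 0) hNn hW.cols hM₁ (by decide) ?_ ?_ ?_ ?_ ?_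
    · intro M' hf
      simp [hf 0 (by decide) (by decide), h₁.n]
    · simp [Mem.write_apply]
    · intro l
      simp [hI l]
    · intro j hj M₂ hM₂ hf₂ h18 hI₂
      have h₂ : d.HeldBy M₂ := h₁.congr fun a ha => hf₂ a (by omega) (by
        interval_cases a <;> decide)
      have e17 : M₂ 17 0 = k := by rw [hf₂ 17 (by decide) (by decide), h17]
      have e6 : M₂ 6 0 = d.pScale := by
        rw [hf₂ 6 (by decide) (by decide), hf₁ 6 (by decide) (by decide), h6]
      have hlt : k / d.n * d.n + j < d.m * d.n := by
        have : k / d.n + 1 ≤ d.m := Nat.div_lt_of_lt_mul (by rwa [mul_comm])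
        nlinarith
      have e9 : M₂ 9 ((k / d.n * d.n + j : ℕ) : ℤ) = d.capped (k / d.n * d.n + j) := by
        rw [hf₂ 9 (by decide) (by decide), hf₁ 9 (by decide) (by decide), h9 _ hlt]
      have ek : (Expr.var 17).eval M₂ = (k : ℤ) := by simp [e17]
      have ekj : (Expr.var 17 / nExpr * nExpr + .var 18).eval M₂ =
          ((k / d.n * d.n + j : ℕ) : ℤ) := by
        simp [e17, h₂.n, h18]
      have t : ((procExpr (.var 17 / nExpr * nExpr + .var 18) - procExpr (.var 17)) * nExpr +
          (Expr.mod (.var 17) nExpr - .var 18)).eval M₂ =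
          (d.proc (k / d.n * d.n + j) - d.proc k) * d.n + (((k % d.n : ℕ) : ℤ) - j) := by
        rw [Expr.eval_add, Expr.eval_mul, Expr.eval_sub, h₂.eval_procExpr e6 ekj,
          h₂.eval_procExpr e6 ek]
        simp [h₂.n, e17, h18]
      have es := sum_range_succ (d.shift k) j
      refine .ite hM₂ (fun c => ?_) fun c => ?_
      all_goals rw [t] at c
      · have ev : (Expr.get 10 (.var 17) + .get 9 (.var 17 / nExpr * nExpr + .var 18)).eval M₂ =
            ∑ j ∈ range (j + 1), d.shift k j := by
          rw [Expr.eval_add, Expr.eval_get _ 9, ekj, e9, es, Tables.shift, if_pos c]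
          simp [e17, hI₂ k]
        refine .assign hM₂ ?_ ?_
        · rw [ev]
          exact hW.pos k hk (j + 1) hj
        · intro l
          rw [ev]
          simp only [Mem.write_apply, Expr.eval_get, Expr.eval_zero, e17, Nat.cast_inj, true_and]
          rw [hI₂ l]
          grind
      · refine .skip hM₂ fun l => ?_
        have : d.shift k j = 0 := by rw [Tables.shift, if_neg c]
        rw [hI₂ l, es, this, add_zero]
    · intro M' _ _ hI' l
      rw [hI' l]
      grind [Tables.pos]
  · intro M' _ _ hI k hk
    simp [hI k, hk]

end MinNorm

/-! ### Correctness of the matching phase -/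

namespace MinNorm

open Finset

variable {d : Tables} {N W : ℕ} {M : Mem}

/-- The memory before the matching phase. -/
structure Tables.Prepared (d : Tables) (M : Mem) : Prop where
  held : d.HeldBy M
  xScale : M 7 0 = d.xScale
  capped : ∀ k < d.m * d.n, M 9 (k : ℕ) = d.capped k
  pos : ∀ k < d.m * d.n, M 10 (k : ℕ) = d.pos k

theorem Tables.Prepared.congr {M' : Mem} (h : d.Prepared M)
    (hM : ∀ a, a < 5 ∨ a = 7 ∨ a = 9 ∨ a = 10 → M' a = M a) : d.Prepared M' where
  held := h.held.congr fun a ha => hM a (.inl ha)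
  xScale := by rw [hM 7 (by simp), h.xScale]
  capped := by rw [hM 9 (by simp)]; exact h.capped
  pos := by rw [hM 10 (by simp)]; exact h.pos

theorem runs_searchProg (hW : d.BoundedBy W) (hN : d.m * d.n ≤ N) (hM : M.BoundedBy W)
    (h : d.Prepared M) {price : ℕ → ℕ} (hpr : ∀ q : ℕ, M 12 q = price q) {j : ℕ} (hj : j < d.n)
    (h13 : M 13 0 = ((j + 1 : ℕ) : ℤ)) (hex : ∃ q < d.m * d.n, d.Adj j q ∧ price q < d.n) :
    Runs N W searchProg M (fun M' => ∃ b < d.m * d.n, M' 14 0 = b ∧ d.Adj j b ∧ price b < d.n ∧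
      ∀ q < d.m * d.n, d.Adj j q → price b ≤ price q) := by
  have hn : 0 < d.n := by omega
  have e0 : nExpr.eval M = (d.n : ℤ) := by simp [h.held.n]
  refine .seq (.assign hM ?_ fun hM₁ => ?_)
  · rw [e0]
    exact hW.cols
  rw [e0] at hM₁ ⊢
  -- `v` is a lower bound for the adjacent slots seen so far, and it is either still the initial `n`
  -- or attained by the recorded slot.
  refine .forLoop (fun q M' => ∃ v : ℕ, M' 15 0 = v ∧ (∀ q' < q, d.Adj j q' → v ≤ price q') ∧
    (v = d.n ∨ ∃ b < q, M' 14 0 = b ∧ v = price b ∧ d.Adj j b ∧ price b < d.n)) hN hW.cells hM₁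
    (by decide) ?_ ?_ ?_ ?_ ?_
  · intro M' hf
    have e : M' 0 = M 0 := by
      rw [hf 0 (by decide) (by decide), Mem.write_of_ne _ _ _ _ (by decide)]
    simp [e, h.held.m, h.held.n]
  · simp [Mem.write_apply]
  · exact ⟨d.n, by simp [Mem.write_apply], by simp, .inl rfl⟩
  · rintro q hq M₂ hM₂ hf h19 ⟨v, h15, hv, hb⟩
    have hfr : ∀ a, a ≠ 19 → a ≠ 15 → a ∉ searchBody.writes → M₂ a = M a := by
      intro a h1 h2 h3
      rw [hf a h1 h3, Mem.write_of_ne _ _ _ _ h2]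
    have h₂ : d.Prepared M₂ := h.congr fun a ha => by
      refine hfr a (by omega) (by omega) ?_
      rcases ha with ha | rfl | rfl | rfl
      · interval_cases a <;> decide
      all_goals decide
    have hp₂ : ∀ q : ℕ, M₂ 12 q = price q := by
      rwa [hfr 12 (by decide) (by decide) (by decide)]
    have e13 : M₂ 13 0 = ((j + 1 : ℕ) : ℤ) := by
      rw [hfr 13 (by decide) (by decide) (by decide), h13]
    have hlt : q / d.n * d.n + j < d.m * d.n := by
      have : q / d.n + 1 ≤ d.m := Nat.div_lt_of_lt_mul (by rwa [mul_comm])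
      nlinarith
    have ee : entryExpr.eval M₂ = ((q / d.n * d.n + j : ℕ) : ℤ) := by
      simp [entryExpr, h19, h₂.held.n, e13]
    have em : (Expr.mod (.var 19) nExpr).eval M₂ = ((q % d.n : ℕ) : ℤ) := by
      simp [h19, h₂.held.n]
    have t1 : (Expr.get 9 entryExpr).eval M₂ = d.capped (q / d.n * d.n + j) := by
      rw [Expr.eval_get, ee, h₂.capped _ hlt]
    have t2 : ((Expr.mod (.var 19) nExpr + 1) * .var 7 - .get 10 entryExpr).eval M₂ =
        (((q % d.n : ℕ) : ℤ) + 1) * d.xScale - d.pos (q / d.n * d.n + j) := by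
      rw [Expr.eval_sub, Expr.eval_mul, Expr.eval_add, em, Expr.eval_get _ 10, ee, h₂.pos _ hlt]
      simp [h₂.xScale]
    have t3 : (.get 10 entryExpr + .get 9 entryExpr - Expr.mod (.var 19) nExpr * .var 7).eval M₂ =
        d.pos (q / d.n * d.n + j) + d.capped (q / d.n * d.n + j) -
          ((q % d.n : ℕ) : ℤ) * d.xScale := by
      rw [Expr.eval_sub, Expr.eval_mul, Expr.eval_add, em, Expr.eval_get _ 10, ee, h₂.pos _ hlt,
        t1]
      simp [h₂.xScale]
    have t4 : (.var 15 - .get 12 (.var 19) : Expr).eval M₂ = (v : ℤ) - price q := by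
      simp [h15, h19, hp₂]
    -- Common treatment of the four branches that leave the memory unchanged: the slot is not
    -- adjacent or not cheaper.
    have hno : (d.Adj j q → v ≤ price q) → Runs N W .skip M₂ (fun M' => ∃ v : ℕ, M' 15 0 = v ∧
        (∀ q' < q + 1, d.Adj j q' → v ≤ price q') ∧ (v = d.n ∨
          ∃ b < q + 1, M' 14 0 = b ∧ v = price b ∧ d.Adj j b ∧ price b < d.n)) := by
      intro hle
      refine .skip hM₂ ⟨v, h15, fun q' hq' ha => ?_, hb.imp_right ?_⟩
      · rcases Nat.lt_succ_iff_lt_or_eq.1 hq' with h1 | rfl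
        · exact hv q' h1 ha
        · exact hle ha
      · rintro ⟨b, hb, h⟩
        exact ⟨b, by omega, h⟩
    refine .ite hM₂ (fun c1 => .ite hM₂ (fun c2 => .ite hM₂ (fun c3 => .ite hM₂ (fun c4 => ?_)
      fun c4 => hno fun _ => ?_) fun c3 => hno fun ha => ?_) fun c2 => hno fun ha => ?_)
      fun c1 => hno fun ha => ?_
    · rw [t1] at c1
      rw [t2] at c2
      rw [t3] at c3
      rw [t4] at c4
      have hvn : v ≤ d.n := by
        rcases hb with rfl | ⟨b, _, _, rfl, _, h⟩
        · exact le_rfl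
        · exact h.le
      have ev : (Expr.get 12 (.var 19)).eval M₂ = (price q : ℤ) := by simp [h19, hp₂]
      have hc := hW.cols
      have hc' := hW.cells
      have hw : ((Expr.get 12 (.var 19)).eval M₂).natAbs ≤ W := by
        rw [ev]
        omega
      refine .seq (.assign hM₂ hw fun hM₃ => .assign hM₃ ?_ ⟨price q, ?_, ?_, .inr ⟨q, ?_⟩⟩)
      · simp only [Expr.eval_get, Expr.eval_zero, Mem.write_apply, Nat.reduceEqDiff,
          false_and, if_false, h19]
        omega
      · simp [Mem.write_apply, h19, hp₂]
      · intro q' hq' ha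
        rcases Nat.lt_succ_iff_lt_or_eq.1 hq' with h1 | rfl
        · exact le_trans (by omega) (hv q' h1 ha)
        · exact le_rfl
      · refine ⟨by omega, ?_, rfl, ⟨c1, c2, c3⟩, by omega⟩
        simp [Mem.write_apply, h19]
    · rw [t4] at c4
      omega
    · rw [t3] at c3
      exact absurd ha.2.2 c3
    · rw [t2] at c2
      exact absurd ha.2.1 c2
    · rw [t1] at c1
      exact absurd ha.1 c1
  · rintro M' - - ⟨v, -, hv, hb⟩
    obtain ⟨q, hq, ha, hlt⟩ := hex
    rcases hb with rfl | ⟨b, hb, h14, rfl, hab, hbn⟩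
    · exact absurd (hv q hq ha) (by omega)
    · exact ⟨b, hb, h14, hab, hbn, hv⟩

/-- The memory represents a state of the auction, and array `5` holds the rows of the slots of
the assigned jobs. -/
structure Tables.Represents (d : Tables) (M : Mem) (owner price : ℕ → ℕ) : Prop where
  owner_eq : ∀ q : ℕ, M 11 q = owner q
  price_eq : ∀ q : ℕ, M 12 q = price q
  out_eq : ∀ q < d.m * d.n, ∀ j : ℕ, owner q = j + 1 → M 5 j = ((q / d.n : ℕ) : ℤ)

theorem Tables.Represents.congr {M' : Mem} {owner price : ℕ → ℕ} (h : d.Represents M owner price)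
    (h5 : M' 5 = M 5) (h11 : M' 11 = M 11) (h12 : M' 12 = M 12) :
    d.Represents M' owner price where
  owner_eq := by rw [h11]; exact h.owner_eq
  price_eq := by rw [h12]; exact h.price_eq
  out_eq := by rw [h5]; exact h.out_eq

/-- By `hne` the bidding job owns no other slot, so overwriting its entry in array `5` cannot
falsify `out_eq` for the slots that keep their owner. -/
theorem runs_takeProg (hW : d.BoundedBy W) (hM : M.BoundedBy W) (h : d.HeldBy M)
    {owner price : ℕ → ℕ} (hr : d.Represents M owner price) {j b : ℕ} (hj : j < d.n)
    (hb : b < d.m * d.n) (h13 : M 13 0 = ((j + 1 : ℕ) : ℤ)) (h14 : M 14 0 = b)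
    (hown : owner b ≤ d.n) (hne : ∀ q < d.m * d.n, owner q ≠ j + 1) (hpr : price b < d.n) :
    Runs N W takeProg M (fun M' => M' 13 0 = owner b ∧
      d.Represents M' (Function.update owner b (j + 1))
        (Function.update price b (price b + 1))) := by
  have hc := hW.cols
  have hc' := hW.cells
  have hdiv : b / d.n ≤ b := Nat.div_le_self _ _
  have hbd : ((b : ℤ) / d.n).natAbs ≤ W := by
    rw [← Int.natCast_div, Int.natAbs_natCast]
    omega
  have ep := hr.price_eq b
  have eo := hr.owner_eq b
  refine .seq (.assign hM ?_ fun hM₁ => .seq (.assign hM₁ ?_ fun hM₂ => .seq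
    (.assign hM₂ ?_ fun hM₃ => .seq (.assign hM₃ ?_ fun hM₄ => .assign hM₄ ?_ ⟨?_, ?_, ?_, ?_⟩))))
  · simpa [h14, h.n] using hbd
  · simp [Mem.write_apply, h14, eo]
    omega
  · simp [Mem.write_apply, h13]
    omega
  · simp [Mem.write_apply, h14, ep]
    omega
  · simp [Mem.write_apply, h14, eo]
    omega
  · simp [Mem.write_apply, h14, eo]
  · intro q
    by_cases hq : q = b <;> simp [Mem.write_apply, h13, h14, hq, hr.owner_eq]
  · intro q
    by_cases hq : q = b <;> simp [Mem.write_apply, h14, hq, hr.price_eq]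
  · intro q hq l hl
    by_cases hqb : q = b
    · subst hqb
      simp only [Function.update_self, Nat.add_right_cancel_iff] at hl
      subst hl
      simp [Mem.write_apply, h13, h14, h.n]
    · simp only [ne_eq, hqb, not_false_eq_true, Function.update_of_ne] at hl
      have hlj : l ≠ j := by
        rintro rfl
        exact hne q hq hl
      simp [Mem.write_apply, h13, h14, hlj, hr.out_eq q hq l hl]

/-- The matching `μ` is not available to the program; it only guarantees that each search succeeds.
The inner loop is counted by the sum of prices, which is below `m * n * n` whenever a bid is made.
-/
theorem runs_matchProg (hW : d.BoundedBy W) (hN : d.m * d.n ≤ N) (hNn : d.n ≤ N)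
    (hN' : d.m * d.n * d.n ≤ N) (hM : M.BoundedBy W) (h : d.Prepared M)
    (h11 : ∀ q : ℕ, M 11 q = 0) (h12 : ∀ q : ℕ, M 12 q = 0)
    {μ : ℕ → ℕ} (hμ : ∀ j < d.n, μ j < d.m * d.n ∧ d.Adj j (μ j))
    (hinj : Set.InjOn μ (Set.Iio d.n)) :
    Runs N W matchProg M (fun M' => ∃ slot : ℕ → ℕ, Set.InjOn slot (Set.Iio d.n) ∧
      ∀ j < d.n, slot j < d.m * d.n ∧ d.Adj j (slot j) ∧
        M' 5 j = ((slot j / d.n : ℕ) : ℤ)) := by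
  have hc := hW.cols
  refine .forLoop (fun J M' => ∃ owner price : ℕ → ℕ,
    AuctionState d.Adj d.n (d.m * d.n) J 0 owner price ∧ d.Represents M' owner price)
    hNn hW.cols hM (by decide) ?_ ?_ ?_ ?_ ?_
  · intro M' hf
    simp [hf 0 (by decide) (by decide), h.held.n]
  · rintro k M' w ⟨owner, price, hs, hr⟩
    exact ⟨owner, price, hs, hr.congr (Mem.write_of_ne _ _ _ _ (by decide))
      (Mem.write_of_ne _ _ _ _ (by decide)) (Mem.write_of_ne _ _ _ _ (by decide))⟩
  · exact ⟨_, _, .init, by simpa using h11, by simpa using h12, by simp⟩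
  · rintro J hJ M₁ hM₁ hf₁ h18 ⟨owner, price, hs, hr⟩
    have h₁ : d.Prepared M₁ := h.congr fun a ha => by
      refine hf₁ a (by omega) ?_
      rcases ha with ha | rfl | rfl | rfl
      · interval_cases a <;> decide
      all_goals decide
    have e13 : (Expr.var 18 + 1).eval M₁ = ((J + 1 : ℕ) : ℤ) := by simp [h18]
    refine .seq (.assign hM₁ ?_ fun hM₂ => ?_)
    · rw [e13]
      omega
    refine .loop (fun k M' => ∃ (cur : ℕ) (owner' price' : ℕ → ℕ), M' 13 0 = cur ∧
      AuctionState d.Adj d.n (d.m * d.n) (J + 1) cur owner' price' ∧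
      d.Represents M' owner' price' ∧ d.Prepared M' ∧ k ≤ ∑ q ∈ range (d.m * d.n), price' q) hM₂
      ⟨J + 1, owner, price, ?_, hs.next, hr.congr ?_ ?_ ?_, h₁.congr ?_, Nat.zero_le _⟩ ?_ ?_
    · rw [e13]
      simp [Mem.write_apply]
    iterate 3 exact Mem.write_of_ne _ _ _ _ (by decide)
    · exact fun a ha => Mem.write_of_ne _ _ _ _ (by omega)
    · rintro k M₃ hM₃ ⟨cur, ow, pr, h13, hs₃, hr₃, h₃, hk⟩ hpos
      obtain ⟨j, rfl⟩ : ∃ j, cur = j + 1 := by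
        refine Nat.exists_eq_succ_of_ne_zero ?_
        rintro rfl
        simp [h13] at hpos
      have hj : j < d.n := by
        have := hs₃.cur_le
        omega
      obtain ⟨q, hq, ha, hlt⟩ := hs₃.exists_price_lt hJ hμ hinj
      refine ⟨by
        have := hs₃.sum_price_lt hq hlt
        omega, .seq (.mono (runs_searchProg hW hN hM₃ h₃ hr₃.price_eq hj h13 ⟨q, hq, ha, hlt⟩) ?_)⟩
      rintro M₄ hf₄ ⟨b, hb, h14, hab, hbn, hmin⟩ hM₄
      have h₄ : d.Prepared M₄ := h₃.congr fun a ha => by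
        refine hf₄ a ?_
        rcases ha with ha | rfl | rfl | rfl
        · interval_cases a <;> decide
        all_goals decide
      have hr₄ := hr₃.congr (hf₄ 5 (by decide)) (hf₄ 11 (by decide)) (hf₄ 12 (by decide))
      have e13' : M₄ 13 0 = ((j + 1 : ℕ) : ℤ) := by rw [hf₄ 13 (by decide), h13]
      refine .mono (runs_takeProg hW hM₄ h₄.held hr₄ hj hb e13' h14
        ((hs₃.owner_le b hb).trans hJ) (hs₃.cur_ne (Nat.succ_ne_zero j)) hbn) ?_
      rintro M₅ hf₅ ⟨h5, hr₅⟩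
      refine ⟨_, _, _, h5, hs₃.step hb hab hbn hmin, hr₅, h₄.congr fun a ha => ?_, ?_⟩
      · refine hf₅ a ?_
        rcases ha with ha | rfl | rfl | rfl
        · interval_cases a <;> decide
        all_goals decide
      · rw [sum_update_of_mem (mem_range.2 hb), add_right_comm, ← sum_update_of_mem
          (mem_range.2 hb), Function.update_eq_self]
        omega
    · rintro k M' ⟨cur, ow, pr, h13, hs', hr', -, -⟩ hpos
      obtain rfl : cur = 0 := by
        simp only [Expr.eval_get, Expr.eval_zero, h13] at hpos
        omega
      exact ⟨ow, pr, hs', hr'⟩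
  · rintro M' - - ⟨owner, price, hs, hr⟩
    have hex : ∀ j, ∃ q, j < d.n → q < d.m * d.n ∧ owner q = j + 1 := by
      intro j
      by_cases hj : j < d.n
      · rcases hs.assigned j hj with h1 | ⟨q, hq, h1⟩
        · omega
        · exact ⟨q, fun _ => ⟨hq, h1⟩⟩
      · exact ⟨0, fun h => absurd h hj⟩
    choose slot hslot using hex
    refine ⟨slot, fun j hj j' hj' heq => ?_, fun j hj => ?_⟩
    · have h1 := (hslot j hj).2
      have h2 := (hslot j' hj').2
      rw [heq] at h1
      omega
    · obtain ⟨h1, h2⟩ := hslot j hj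
      exact ⟨h1, hs.adj _ h1 j h2, hr.out_eq _ h1 j h2⟩

theorem runs_roundProg (hW : d.BoundedBy W) (hNm : d.m ≤ N) (hNn : d.n ≤ N)
    (hN : d.m * d.n ≤ N) (hN' : d.m * d.n * d.n ≤ N) (hM : M.BoundedBy W) (h : d.HeldBy M)
    (h0 : ∀ a, 5 ≤ a → ∀ k, M a k = 0)
    {μ : ℕ → ℕ} (hμ : ∀ j < d.n, μ j < d.m * d.n ∧ d.Adj j (μ j))
    (hinj : Set.InjOn μ (Set.Iio d.n)) :
    Runs N W roundProg M (fun M' => ∃ slot : ℕ → ℕ, Set.InjOn slot (Set.Iio d.n) ∧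
      ∀ j < d.n, slot j < d.m * d.n ∧ d.Adj j (slot j) ∧
        M' 5 j = ((slot j / d.n : ℕ) : ℤ)) := by
  refine .seq (.mono (runs_scaleProg hW hN hM h) ?_)
  rintro M₁ hf₁ ⟨h6, h7⟩ hM₁
  have k₁ : d.HeldBy M₁ := h.congr fun a ha => hf₁ a (by interval_cases a <;> decide)
  refine .seq (.mono (runs_costProg hW hNm hNn hM₁ k₁ h6 h7 ?_) ?_)
  · intro j
    rw [hf₁ 8 (by decide), h0 8 (by decide)]
  intro M₂ hf₂ h8 hM₂
  have k₂ : d.HeldBy M₂ := k₁.congr fun a ha => hf₂ a (by interval_cases a <;> decide)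
  have h6₂ : M₂ 6 0 = d.pScale := by rw [hf₂ 6 (by decide), h6]
  have h7₂ : M₂ 7 0 = d.xScale := by rw [hf₂ 7 (by decide), h7]
  refine .seq (.mono (runs_cappedProg hW hN hM₂ k₂ h6₂ h7₂ h8 ?_) ?_)
  · intro j
    rw [hf₂ 9 (by decide), hf₁ 9 (by decide), h0 9 (by decide)]
  intro M₃ hf₃ h9 hM₃
  have k₃ : d.HeldBy M₃ := k₂.congr fun a ha => hf₃ a (by interval_cases a <;> decide)
  have h6₃ : M₃ 6 0 = d.pScale := by rw [hf₃ 6 (by decide), h6₂]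
  have h7₃ : M₃ 7 0 = d.xScale := by rw [hf₃ 7 (by decide), h7₂]
  refine .seq (.mono (runs_posProg hW hN hNn hM₃ k₃ h6₃ h9 ?_) ?_)
  · intro j
    rw [hf₃ 10 (by decide), hf₂ 10 (by decide), hf₁ 10 (by decide), h0 10 (by decide)]
  intro M₄ hf₄ h10 hM₄
  have k₄ : d.HeldBy M₄ := k₃.congr fun a ha => hf₄ a (by interval_cases a <;> decide)
  refine runs_matchProg hW hN hNn hN' hM₄ ⟨k₄, ?_, ?_, h10⟩ ?_ ?_ hμ hinj
  · rw [hf₄ 7 (by decide), h7₃]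
  · rw [hf₄ 9 (by decide)]
    exact h9
  · intro q
    rw [hf₄ 11 (by decide), hf₃ 11 (by decide), hf₂ 11 (by decide), hf₁ 11 (by decide),
      h0 11 (by decide)]
  · intro q
    rw [hf₄ 12 (by decide), hf₃ 12 (by decide), hf₂ 12 (by decide), hf₁ 12 (by decide),
      h0 12 (by decide)]

end MinNorm

namespace MinNorm

open Finset

/-! ### Slots of a machine

The jobs of a machine are arranged on the real line in the order of a key, job `j` taking up an
interval of length `y j`. Slot `s` is the interval from `s` to `s + 1`. -/

/-- Jobs that are lined up in the order of a key form a telescope. -/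
theorem sum_telescope {ι α : Type*} [LinearOrder α] {key : ι → α}
    (hkey : Function.Injective key) (y : ι → ℝ) (F : ℝ → ℝ) (S : Finset ι) :
    ∑ j ∈ S, (F (∑ l ∈ S with key l < key j, y l + y j) - F (∑ l ∈ S with key l < key j, y l)) =
      F (∑ j ∈ S, y j) - F 0 := by
  classical
  -- A job with the largest key is appended at the right end and moves none of the others.
  induction S using Finset.induction_on_max_value key with
  | empty => simp
  | insert a S ha hmax ih =>
    have hlt : ∀ l ∈ S, key l < key a := fun l hl =>
      lt_of_le_of_ne (hmax l hl) fun h => ha (hkey h ▸ hl)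
    rw [sum_insert ha, sum_insert ha]
    have h1 : (insert a S).filter (fun l => key l < key a) = S := by
      ext l
      simp only [mem_filter, mem_insert]
      refine ⟨?_, fun h => ⟨.inr h, hlt l h⟩⟩
      rintro ⟨rfl | h, h'⟩
      · exact absurd h' (lt_irrefl _)
      · exact h
    have h2 : ∀ j ∈ S, (insert a S).filter (fun l => key l < key j) =
        S.filter (fun l => key l < key j) := by
      intro j hj
      rw [filter_insert, if_neg (hlt j hj).le.not_gt]
    have h3 : ∑ j ∈ S, (F (∑ l ∈ insert a S with key l < key j, y l + y j) -
        F (∑ l ∈ insert a S with key l < key j, y l)) = F (∑ j ∈ S, y j) - F 0 := by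
      rw [← ih]
      exact sum_congr rfl fun j hj => by rw [h2 j hj]
    rw [h1, h3, add_comm (y a)]
    ring

section Slots

variable {ι α : Type*} [Fintype ι] [LinearOrder α] {key : ι → α} {y p : ι → ℝ}

/-- The left end of the interval of a job. -/
def start (key : ι → α) (y : ι → ℝ) (j : ι) : ℝ := ∑ l with key l < key j, y l

/-- The point of slot `s` that is closest to `t`. -/
def clamp (s t : ℝ) : ℝ := min (max t s) (s + 1)

/-- The length of the intersection of the interval of job `j` with slot `s`. -/
def overlap (key : ι → α) (y : ι → ℝ) (s : ℝ) (j : ι) : ℝ :=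
  clamp s (start key y j + y j) - clamp s (start key y j)

/-- The intersection of the interval of job `j` with slot `s` is not negligible. -/
def Meets (key : ι → α) (y : ι → ℝ) (s : ℝ) (j : ι) : Prop :=
  0 < y j ∧ start key y j < s + 1 ∧ s < start key y j + y j

theorem clamp_mono (s : ℝ) : Monotone (clamp s) :=
  fun _ _ h => min_le_min_right _ (max_le_max_right _ h)

theorem le_clamp (s t : ℝ) : s ≤ clamp s t := le_min (le_max_right _ _) (by linarith)

theorem clamp_le (s t : ℝ) : clamp s t ≤ s + 1 := min_le_right _ _

theorem clamp_of_le {s t : ℝ} (h : t ≤ s) : clamp s t = s := by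
  simp [clamp, h]

theorem clamp_of_ge {s t : ℝ} (h : s + 1 ≤ t) : clamp s t = s + 1 :=
  min_eq_right (h.trans (le_max_left _ _))

/-- The slots `0, …, K - 1` tile the interval from `0` to `K`, so summing overlaps over them
measures the part of a job's interval to the left of `K`. -/
theorem sum_clamp {t : ℝ} (ht : 0 ≤ t) (K : ℕ) :
    ∑ s ∈ range K, (clamp s t - s) = min t K := by
  induction K with
  | zero => simp [ht]
  | succ K ih =>
    rw [sum_range_succ, ih, Nat.cast_succ]
    rcases le_total t K with h | h
    · rw [clamp_of_le h, min_eq_left h, min_eq_left (by linarith)]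
      ring
    · rw [clamp, max_eq_left h, min_eq_right h]
      ring

theorem overlap_nonneg (hy : ∀ j, 0 ≤ y j) (s : ℝ) (j : ι) : 0 ≤ overlap key y s j :=
  sub_nonneg.2 (clamp_mono s (by linarith [hy j]))

theorem start_nonneg (hy : ∀ j, 0 ≤ y j) (j : ι) : 0 ≤ start key y j :=
  sum_nonneg fun l _ => hy l

theorem start_add_le (hy : ∀ j, 0 ≤ y j) {j j' : ι} (h : key j < key j') :
    start key y j + y j ≤ start key y j' := by
  classical
  have hj : j ∉ univ.filter (fun l => key l < key j) := by simp
  rw [start, add_comm, ← sum_insert hj]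
  refine sum_le_sum_of_subset_of_nonneg ?_ fun l _ _ => hy l
  intro l hl
  simp only [mem_insert, mem_filter, mem_univ, true_and] at hl ⊢
  rcases hl with rfl | hl
  · exact h
  · exact hl.trans h

theorem start_add_le_sum (hy : ∀ j, 0 ≤ y j) (j : ι) : start key y j + y j ≤ ∑ l, y l := by
  classical
  have hj : j ∉ univ.filter (fun l => key l < key j) := by simp
  rw [start, add_comm, ← sum_insert hj]
  exact sum_le_sum_of_subset_of_nonneg (subset_univ _) fun l _ _ => hy l

/-- The intervals are contiguous, so the telescope for `clamp s` leaves only the two ends of the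
line. -/
theorem sum_overlap (hkey : Function.Injective key) (s : ℝ) :
    ∑ j, overlap key y s j = clamp s (∑ j, y j) - clamp s 0 :=
  sum_telescope hkey y (clamp s) univ

theorem sum_overlap_le_one (hkey : Function.Injective key) (s : ℝ) :
    ∑ j, overlap key y s j ≤ 1 := by
  rw [sum_overlap hkey]
  linarith [le_clamp s 0, clamp_le s (∑ j, y j)]

theorem sum_overlap_eq_one (hkey : Function.Injective key) {s : ℝ} (hs : 0 ≤ s)
    (h : s + 1 ≤ ∑ j, y j) : ∑ j, overlap key y s j = 1 := by
  rw [sum_overlap hkey, clamp_of_ge h, clamp_of_le hs]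
  ring

theorem sum_range_overlap (hy : ∀ j, 0 ≤ y j) (K : ℕ) (j : ι) :
    ∑ s ∈ range K, overlap key y s j =
      min (start key y j + y j) K - min (start key y j) K := by
  have h := start_nonneg (key := key) hy j
  rw [← sum_clamp (by linarith [hy j]), ← sum_clamp h, ← sum_sub_distrib]
  exact sum_congr rfl fun s _ => by
    rw [overlap]
    ring

theorem sum_range_overlap_le (hy : ∀ j, 0 ≤ y j) (K : ℕ) (j : ι) :
    ∑ s ∈ range K, overlap key y s j ≤ y j := by
  rw [sum_range_overlap hy]
  rcases le_total (start key y j) K with h | h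
  · rw [min_eq_left h]
    linarith [min_le_left (start key y j + y j) K]
  · rw [min_eq_right h, min_eq_right (by linarith [hy j])]
    linarith [hy j]

theorem sum_range_overlap_eq (hy : ∀ j, 0 ≤ y j) {K : ℕ} (hK : ∑ j, y j ≤ K) (j : ι) :
    ∑ s ∈ range K, overlap key y s j = y j := by
  have h := start_add_le_sum (key := key) hy j
  rw [sum_range_overlap hy, min_eq_left (h.trans hK), min_eq_left (by linarith [hy j])]
  ring

theorem overlap_eq_zero (hy : ∀ j, 0 ≤ y j) {s : ℝ} {j : ι} (h : ¬ Meets key y s j) :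
    overlap key y s j = 0 := by
  have hj := hy j
  rw [overlap]
  by_cases h1 : start key y j < s + 1
  · by_cases h2 : s < start key y j + y j
    · have h3 : y j = 0 := le_antisymm (not_lt.1 fun h3 => h ⟨h3, h1, h2⟩) hj
      rw [h3, add_zero, sub_self]
    · rw [clamp_of_le (not_lt.1 h2), clamp_of_le (by linarith), sub_self]
  · rw [clamp_of_ge (by linarith), clamp_of_ge (not_lt.1 h1), sub_self]

/-- If the jobs are ordered by decreasing length, then a job that meets slot `s + 1` is at most as
long as the average of slot `s`. -/
theorem le_sum_overlap (hkey : Function.Injective key) (hy : ∀ j, 0 ≤ y j)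
    (hp : ∀ j l, key l ≤ key j → p j ≤ p l) {s : ℕ} {j : ι}
    (h : Meets key y ((s + 1 : ℕ) : ℝ) j) : p j ≤ ∑ l, p l * overlap key y s l := by
  have hsum := start_add_le_sum (key := key) hy j
  have h3 := h.2.2
  push_cast at h3
  -- Job `j` reaches beyond `s + 1`, so slot `s` is full and its overlaps are the weights of an
  -- average.
  have h1 : p j = ∑ l, p j * overlap key y s l := by
    rw [← mul_sum, sum_overlap_eq_one hkey (Nat.cast_nonneg s) (by linarith), mul_one]
  rw [h1]
  refine sum_le_sum fun l _ => ?_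
  by_cases hl : key l ≤ key j
  · exact mul_le_mul_of_nonneg_right (hp j l hl) (overlap_nonneg hy _ _)
  · have h2 := start_add_le hy (not_le.1 hl)
    rw [overlap_eq_zero hy (fun hm => by linarith [hm.2.1]), mul_zero, mul_zero]

/-- Each job in a slot `s + 1` is charged to the average of slot `s`. Different jobs charge
different slots, so the charges add up to at most `∑ p j * y j`; the at most one job in slot `0` is
paid for by `B`. -/
theorem sum_le_of_meets (hkey : Function.Injective key) (hy : ∀ j, 0 ≤ y j)
    (hp : ∀ j l, key l ≤ key j → p j ≤ p l) (hp0 : ∀ j, 0 ≤ p j) {S : Finset ι} {slot : ι → ℕ}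
    (hinj : Set.InjOn slot S) (hS : ∀ j ∈ S, Meets key y (slot j) j) {B : ℝ} (hB : 0 ≤ B)
    (hSB : ∀ j ∈ S, p j ≤ B) : ∑ j ∈ S, p j ≤ ∑ j, p j * y j + B := by
  classical
  rw [← sum_filter_add_sum_filter_not S (fun j => slot j ≠ 0)]
  refine add_le_add ?_ ?_
  · set S' := S.filter (fun j => slot j ≠ 0)
    let K := S.sup slot
    have hinj' : Set.InjOn (fun j => slot j - 1) S' := by
      intro j hj l hl h
      simp only [S', coe_filter, Set.mem_ofPred_eq] at hj hl
      exact hinj hj.1 hl.1 (by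
        have := hj.2
        have := hl.2
        simp only at h
        omega)
    calc ∑ j ∈ S', p j ≤ ∑ j ∈ S', ∑ l, p l * overlap key y ((slot j - 1 : ℕ) : ℝ) l := by
          refine sum_le_sum fun j hj => le_sum_overlap hkey hy hp ?_
          obtain ⟨h1, h2⟩ := mem_filter.1 hj
          rw [Nat.sub_add_cancel (Nat.one_le_iff_ne_zero.2 h2)]
          exact hS j h1
      _ = ∑ s ∈ S'.image (fun j => slot j - 1), ∑ l, p l * overlap key y (s : ℝ) l := by
          rw [sum_image hinj']
      _ ≤ ∑ s ∈ range K, ∑ l, p l * overlap key y (s : ℝ) l := by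
          refine sum_le_sum_of_subset_of_nonneg ?_ fun s _ _ =>
            sum_nonneg fun l _ => mul_nonneg (hp0 l) (overlap_nonneg hy _ _)
          intro s hs
          obtain ⟨j, hj, rfl⟩ := mem_image.1 hs
          obtain ⟨h1, h2⟩ := mem_filter.1 hj
          have h3 : slot j ≤ K := le_sup (f := slot) h1
          exact mem_range.2 (by omega)
      _ = ∑ l, p l * ∑ s ∈ range K, overlap key y (s : ℝ) l := by
          rw [sum_comm]
          simp only [mul_sum]
      _ ≤ ∑ l, p l * y l := sum_le_sum fun l _ =>
          mul_le_mul_of_nonneg_left (sum_range_overlap_le hy K l) (hp0 l)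
  · have hcard : #(S.filter (fun j => ¬ slot j ≠ 0)) ≤ 1 := by
      refine card_le_one.2 fun j hj l hl => ?_
      simp only [ne_eq, not_not, mem_filter] at hj hl
      exact hinj hj.1 hl.1 (hj.2.trans hl.2.symm)
    calc ∑ j ∈ S with ¬ slot j ≠ 0, p j ≤ #(S.filter (fun j => ¬ slot j ≠ 0)) • B :=
          sum_le_card_nsmul _ _ _ fun j hj => hSB j (mem_filter.1 hj).1
      _ ≤ 1 • B := nsmul_le_nsmul_left hB hcard
      _ = B := one_nsmul B

end Slots

/-! ### Existence of a rounding -/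

section Rounding

variable {m n : ℕ} {p x : Fin m → Fin n → ℝ}

/-- The jobs of a machine are ordered by decreasing length. -/
def lengthKey (p : Fin n → ℝ) (j : Fin n) : ℝ ×ₗ Fin n := toLex (-p j, j)

theorem lengthKey_injective (p : Fin n → ℝ) : Function.Injective (lengthKey p) := by
  intro j l h
  simpa [lengthKey] using congrArg (fun a => (ofLex a).2) h

theorem lengthKey_lt (p : Fin n → ℝ) (j l : Fin n) :
    lengthKey p l < lengthKey p j ↔ p j < p l ∨ p j = p l ∧ l < j := by
  rw [lengthKey, lengthKey, Prod.Lex.toLex_lt_toLex]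
  simp [eq_comm]

theorem le_of_lengthKey_le (p : Fin n → ℝ) (j l : Fin n) (h : lengthKey p l ≤ lengthKey p j) :
    p j ≤ p l := by
  rw [lengthKey, lengthKey, Prod.Lex.toLex_le_toLex] at h
  rcases h with h | h
  · exact (neg_lt_neg_iff.1 h).le
  · exact (neg_inj.1 h.1).ge

/-- Job `j` can be put into slot `s` of machine `i` for the fractional solution `y`. -/
def SlotAdj (p y : Fin m → Fin n → ℝ) (j : Fin n) (i : Fin m) (s : ℕ) : Prop :=
  Meets (lengthKey (p i)) (y i) s j

/-- All jobs can be put into different slots. -/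
theorem exists_slots {y : Fin m → Fin n → ℝ} (hy : ∀ i j, 0 ≤ y i j) (hy1 : ∀ i j, y i j ≤ 1)
    (hcov : ∀ j, 1 ≤ ∑ i, y i j) :
    ∃ μ : Fin n → Fin m × Fin n, Function.Injective μ ∧
      ∀ j, SlotAdj p y j (μ j).1 (μ j).2 := by
  classical
  -- Hall's condition follows by double counting overlaps: each job of `J` has total at least `1`,
  -- all inside its neighbouring slots, and each slot has total at most `1`.
  have key := (Finset.all_card_le_biUnion_card_iff_exists_injective
    (fun j : Fin n => univ.filter (fun q : Fin m × Fin n => SlotAdj p y j q.1 q.2))).1 ?_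
  · obtain ⟨μ, h1, h2⟩ := key
    exact ⟨μ, h1, fun j => (mem_filter.1 (h2 j)).2⟩
  intro J
  set T := J.biUnion fun j => univ.filter (fun q : Fin m × Fin n => SlotAdj p y j q.1 q.2)
  -- The cap at `1` makes `n` slots per machine long enough to contain all intervals.
  have hsum : ∀ i, ∑ j, y i j ≤ (n : ℝ) := fun i => by
    simpa using sum_le_sum fun j (_ : j ∈ univ) => hy1 i j
  have hK := fun i => lengthKey_injective (p i)
  have : (#J : ℝ) ≤ #T := by
    calc (#J : ℝ) = ∑ j ∈ J, (1 : ℝ) := by simp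
      _ ≤ ∑ j ∈ J, ∑ i, y i j := sum_le_sum fun j _ => hcov j
      _ = ∑ j ∈ J, ∑ q : Fin m × Fin n, overlap (lengthKey (p q.1)) (y q.1) (q.2 : ℕ) j := by
          refine sum_congr rfl fun j _ => ?_
          rw [Fintype.sum_prod_type]
          refine sum_congr rfl fun i _ => ?_
          rw [Fin.sum_univ_eq_sum_range
            (fun s => overlap (lengthKey (p i)) (y i) ((s : ℕ) : ℝ) j) n,
            sum_range_overlap_eq (hy i) (hsum i)]
      _ = ∑ j ∈ J, ∑ q ∈ T, overlap (lengthKey (p q.1)) (y q.1) (q.2 : ℕ) j := by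
          refine sum_congr rfl fun j hj => (sum_subset (subset_univ T) fun q _ hq => ?_).symm
          refine overlap_eq_zero (hy q.1) fun hm => hq ?_
          exact mem_biUnion.2 ⟨j, hj, mem_filter.2 ⟨mem_univ q, hm⟩⟩
      _ = ∑ q ∈ T, ∑ j ∈ J, overlap (lengthKey (p q.1)) (y q.1) (q.2 : ℕ) j := sum_comm
      _ ≤ ∑ q ∈ T, ∑ j, overlap (lengthKey (p q.1)) (y q.1) (q.2 : ℕ) j :=
          sum_le_sum fun q _ => sum_le_sum_of_subset_of_nonneg (subset_univ J)
            fun j _ _ => overlap_nonneg (hy q.1) _ j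
      _ ≤ ∑ q ∈ T, (1 : ℝ) := sum_le_sum fun q _ => sum_overlap_le_one (hK q.1) _
      _ = #T := by simp
  exact_mod_cast this

/-! ### Filtering and capping keep every job covered -/

theorem filtered_nonneg (hx : ∀ i j, 0 ≤ x i j) (i : Fin m) (j : Fin n) :
    0 ≤ filtered p x i j := by
  unfold filtered
  split_ifs
  · linarith [hx i j]
  · exact le_rfl

theorem filtered_le (hx : ∀ i j, 0 ≤ x i j) (i : Fin m) (j : Fin n) :
    filtered p x i j ≤ 2 * x i j := by
  unfold filtered
  split_ifs
  · exact le_rfl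
  · linarith [hx i j]

theorem le_of_filtered_pos {i : Fin m} {j : Fin n} (h : 0 < filtered p x i j) :
    p i j ≤ 2 * jobCost p x j := by
  by_contra hc
  simp [filtered, hc] at h

/-- The filtered solution assigns every job completely, by Markov's inequality. -/
theorem one_le_sum_filtered (hp : ∀ i j, 0 ≤ p i j) (hx : IsFractionalAssignment x) (j : Fin n) :
    1 ≤ ∑ i, filtered p x i j := by
  have hP : 0 ≤ jobCost p x j := sum_nonneg fun i _ => mul_nonneg (hp i j) (hx.nonneg i j)
  have hcov := hx.covers j
  have hle : ∀ i, x i j ≤ filtered p x i j ∨ 0 < jobCost p x j := by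
    intro i
    rcases hP.eq_or_lt with h0 | h0
    · left
      -- At cost `0` each entry has `p i j = 0`, and is kept, or `x i j = 0`, and loses nothing.
      have h1 : p i j * x i j = 0 :=
        (sum_eq_zero_iff_of_nonneg fun i _ => mul_nonneg (hp i j) (hx.nonneg i j)).1 h0.symm i
          (mem_univ i)
      rcases mul_eq_zero.1 h1 with h2 | h2
      · rw [filtered, if_pos (by rw [h2]; linarith)]
        linarith [hx.nonneg i j]
      · rw [h2]
        exact filtered_nonneg hx.nonneg i j
    · exact .inr h0
  rcases hP.eq_or_lt with h0 | h0
  · exact hcov.trans (sum_le_sum fun i _ => (hle i).resolve_right (by rw [← h0]; simp))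
  -- Markov's inequality entrywise: the factor `2 * x i j - filtered p x i j` vanishes on kept
  -- entries and is `2 * x i j` on dropped ones, where `p i j > 2 P_j`.
  · have h1 : ∀ i, 2 * jobCost p x j * (2 * x i j - filtered p x i j) ≤
        2 * (p i j * x i j) := by
      intro i
      unfold filtered
      split_ifs with h
      · nlinarith [mul_nonneg (hp i j) (hx.nonneg i j)]
      · nlinarith [hx.nonneg i j, not_le.1 h]
    have h2 := sum_le_sum fun i (_ : i ∈ univ) => h1 i
    rw [← mul_sum, ← mul_sum, sum_sub_distrib, ← mul_sum] at h2
    change _ ≤ 2 * jobCost p x j at h2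
    have h3 : 2 * ∑ i, x i j - ∑ i, filtered p x i j ≤ 1 := by
      by_contra hc
      nlinarith [not_le.1 hc]
    linarith

/-- The filtered solution, capped at `1`. -/
noncomputable def cappedFiltered (p x : Fin m → Fin n → ℝ) (i : Fin m) (j : Fin n) : ℝ :=
  min (filtered p x i j) 1

theorem cappedFiltered_nonneg (hx : ∀ i j, 0 ≤ x i j) (i : Fin m) (j : Fin n) :
    0 ≤ cappedFiltered p x i j := le_min (filtered_nonneg hx i j) zero_le_one

/-- If the cap acts on some entry, that entry alone covers the job; otherwise nothing has changed.
-/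
theorem one_le_sum_cappedFiltered (hp : ∀ i j, 0 ≤ p i j) (hx : IsFractionalAssignment x)
    (j : Fin n) : 1 ≤ ∑ i, cappedFiltered p x i j := by
  have h0 := fun i => cappedFiltered_nonneg (p := p) hx.nonneg i j
  by_cases h : ∃ i, 1 ≤ filtered p x i j
  · obtain ⟨i, hi⟩ := h
    calc 1 = cappedFiltered p x i j := (min_eq_right hi).symm
      _ ≤ _ := single_le_sum (f := fun i => cappedFiltered p x i j) (fun i _ => h0 i) (mem_univ i)
  · push Not at h
    refine (one_le_sum_filtered hp hx j).trans_eq (sum_congr rfl fun i _ => ?_)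
    exact (min_eq_left (h i).le).symm

/-! ### The factor `4` for monotone symmetric norms -/

theorem le_longestJob (σ : Fin n → Fin m) (j : Fin n) : p (σ j) j ≤ longestJob p σ (σ j) :=
  (le_fold_max _).2 (.inr ⟨j, by simp, le_rfl⟩)

theorem longestJob_nonneg (σ : Fin n → Fin m) (i : Fin m) : 0 ≤ longestJob p σ i :=
  (le_fold_max _).2 (.inl le_rfl)

theorem IsMonotoneSymmetricNorm.le_of_le {f : (Fin m → ℝ) → ℝ} (hf : IsMonotoneSymmetricNorm f)
    {v w : Fin m → ℝ} (hv : ∀ i, 0 ≤ v i) (hvw : ∀ i, v i ≤ w i) : f v ≤ f w :=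
  hf.monotone v w fun i => mul_nonneg (hv i) (sub_nonneg.2 (hvw i))

theorem IsMonotoneSymmetricNorm.le_two_mul {f : (Fin m → ℝ) → ℝ}
    (hf : IsMonotoneSymmetricNorm f) {v w : Fin m → ℝ} (hv : ∀ i, 0 ≤ v i)
    (hvw : ∀ i, v i ≤ 2 * w i) : f v ≤ 2 * f w := by
  have h := hf.homogeneous 2 w
  rw [abs_of_pos two_pos] at h
  rw [← h]
  exact hf.le_of_le hv hvw

/-- A job lies on only one machine, so the longest jobs of different machines are distinct and fit
into a set `S` of `m` jobs. Symmetry makes their order in `S` irrelevant. -/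
theorem norm_longestJob_le (hmn : m ≤ n) {f : (Fin m → ℝ) → ℝ}
    (hf : IsMonotoneSymmetricNorm f) {σ : Fin n → Fin m} {P : Fin n → ℝ} (hP : ∀ j, 0 ≤ P j)
    (hσ : ∀ j, p (σ j) j ≤ 2 * P j) {T : ℝ}
    (hT : ∀ (S : Finset (Fin n)) (hS : #S = m), f (fun i => P (S.orderEmbOfFin hS i)) ≤ T) :
    f (longestJob p σ) ≤ 2 * T := by
  classical
  -- The machines whose maximum is attained by a job; on all others it is the default `0`.
  let I : Finset (Fin m) := univ.filter fun i => ∃ j, σ j = i ∧ longestJob p σ i ≤ p i j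
  have hI : ∀ i, ∃ j, i ∈ I → σ j = i ∧ longestJob p σ i ≤ p i j := by
    intro i
    by_cases hi : i ∈ I
    · obtain ⟨j, hj⟩ := (mem_filter.1 hi).2
      exact ⟨j, fun _ => hj⟩
    · exact ⟨⟨i, i.2.trans_le hmn⟩, fun h => absurd h hi⟩
  choose J hJ using hI
  have hinj : Set.InjOn J I := by
    intro i hi l hl h
    rw [← (hJ i hi).1, h, (hJ l hl).1]
  -- The constraint concerns sets of exactly `m` jobs, so the longest jobs are padded; this needs `m
  -- ≤ n`.
  obtain ⟨S, hJS, hS⟩ := exists_superset_card_eq (s := I.image J) (n := m)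
    (card_image_le.trans (by simpa using card_le_univ I)) (by simpa using hmn)
  obtain ⟨g, hg⟩ := Finset.exists_equiv_extend_of_card_eq (by simpa using hS.symm) hJS hinj
  let π : Equiv.Perm (Fin m) := g.trans (S.orderIsoOfFin hS).symm.toEquiv
  have hπ : ∀ i, S.orderEmbOfFin hS (π i) = g i := by
    intro i
    rw [← coe_orderIsoOfFin_apply]
    simp [π]
  have hfS : f (fun i => P (g i)) ≤ T := by
    have h := hf.symmetric π (fun i => P (S.orderEmbOfFin hS i))
    simp only [hπ] at h
    exact h.trans_le (hT S hS)
  refine (hf.le_two_mul (longestJob_nonneg σ) fun i => ?_).trans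
    (mul_le_mul_of_nonneg_left hfS two_pos.le)
  by_cases hi : i ∈ I
  · obtain ⟨h1, h2⟩ := hJ i hi
    rw [hg i hi]
    have := hσ (J i)
    rw [h1] at this
    exact h2.trans this
  · have h1 : longestJob p σ i ≤ 0 := by
      rcases (le_fold_max _).1 (le_refl (longestJob p σ i)) with h1 | ⟨j, hj, h1⟩
      · exact h1
      · exact absurd (mem_filter.2 ⟨mem_univ i, j, by simpa using hj, h1⟩) hi
    exact h1.trans (mul_nonneg two_pos.le (hP _))

theorem norm_load_le (hmn : m ≤ n) (hp : ∀ i j, 0 ≤ p i j) {σ : Fin n → Fin m}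
    (hσ : ∀ j, p (σ j) j ≤ 2 * jobCost p x j)
    (hload : ∀ i, load p σ i ≤ machineLoad p (filtered p x) i + longestJob p σ i)
    {f : (Fin m → ℝ) → ℝ} (hf : IsMonotoneSymmetricNorm f) {L : Fin m → ℝ} {P : Fin n → ℝ} {T : ℝ}
    (h : CPFeasible f p x L P T) : f (load p σ) ≤ 4 * T := by
  have hx := h.assignment.nonneg
  have hL : L = machineLoad p x := funext h.load_eq
  have hP : P = jobCost p x := funext h.cost_eq
  have h1 : f (machineLoad p (filtered p x)) ≤ 2 * T := by
    refine (hf.le_two_mul (w := L) ?_ ?_).trans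
      (mul_le_mul_of_nonneg_left h.norm_load_le two_pos.le)
    · exact fun i => sum_nonneg fun j _ => mul_nonneg (hp i j) (filtered_nonneg hx i j)
    · intro i
      rw [hL, machineLoad, machineLoad, mul_sum]
      refine sum_le_sum fun j _ => ?_
      nlinarith [mul_le_mul_of_nonneg_left (filtered_le (p := p) hx i j) (hp i j)]
  have h2 : f (longestJob p σ) ≤ 2 * T := by
    refine norm_longestJob_le hmn hf (P := P) ?_ ?_ h.norm_cost_le
    · exact fun j => hP ▸ sum_nonneg fun i _ => mul_nonneg (hp i j) (hx i j)
    · rwa [hP]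
  have h3 : f (load p σ) ≤ f (machineLoad p (filtered p x) + longestJob p σ) :=
    hf.le_of_le (fun i => sum_nonneg fun j _ => hp i j) hload
  linarith [hf.triangle (machineLoad p (filtered p x)) (longestJob p σ)]

/-- Jobs in different slots form a rounding. -/
theorem isRounding_of_slots (hmn : m ≤ n) (hp : ∀ i j, 0 ≤ p i j) (hx : ∀ i j, 0 ≤ x i j)
    {σ : Fin n → Fin m} {slot : Fin n → ℕ} (hinj : Function.Injective fun j => (σ j, slot j))
    (hadj : ∀ j, SlotAdj p (cappedFiltered p x) j (σ j) (slot j)) : IsRounding p x σ := by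
  have hsupp : ∀ j, 0 < filtered p x (σ j) j := fun j => (hadj j).1.trans_le (min_le_left _ _)
  have hload : ∀ i, load p σ i ≤ machineLoad p (filtered p x) i + longestJob p σ i := by
    intro i
    have h := sum_le_of_meets (S := univ.filter fun j => σ j = i) (slot := slot)
      (lengthKey_injective (p i)) (cappedFiltered_nonneg (p := p) hx i) (le_of_lengthKey_le (p i))
      (hp i) ?_ ?_ (longestJob_nonneg (p := p) σ i) ?_
    · refine h.trans (add_le_add_left (sum_le_sum fun j _ => ?_) _)
      exact mul_le_mul_of_nonneg_left (min_le_left _ _) (hp i j)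
    · intro j hj l hl h
      simp only [coe_filter, mem_univ, true_and, Set.mem_ofPred_eq] at hj hl
      exact hinj (Prod.ext (hj.trans hl.symm) h)
    · intro j hj
      obtain rfl : σ j = i := by simpa using hj
      exact hadj j
    · intro j hj
      obtain rfl : σ j = i := by simpa using hj
      exact le_longestJob σ j
  exact ⟨hsupp, hload, fun f hf L P T h =>
    norm_load_le hmn hp (fun j => le_of_filtered_pos (hsupp j)) hload hf h⟩

theorem exists_slots_cappedFiltered (hp : ∀ i j, 0 ≤ p i j) (hx : IsFractionalAssignment x) :
    ∃ μ : Fin n → Fin m × Fin n, Function.Injective μ ∧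
      ∀ j, SlotAdj p (cappedFiltered p x) j (μ j).1 (μ j).2 :=
  exists_slots (cappedFiltered_nonneg hx.nonneg) (fun _ _ => min_le_right _ _)
    (one_le_sum_cappedFiltered hp hx)

theorem exists_isRounding (hmn : m ≤ n) (hp : ∀ i j, 0 ≤ p i j) (hx : IsFractionalAssignment x) :
    ∃ σ : Fin n → Fin m, IsRounding p x σ := by
  obtain ⟨μ, hinj, hadj⟩ := exists_slots_cappedFiltered hp hx
  refine ⟨fun j => (μ j).1, isRounding_of_slots (slot := fun j => (μ j).2) hmn hp hx.nonneg ?_ hadj⟩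
  intro j l h
  simp only [Prod.mk.injEq] at h
  exact hinj (Prod.ext h.1 (Fin.ext h.2))

end Rounding

end MinNorm

namespace MinNorm

open Finset

/-! ### The rounding program on rational inputs -/

section Input

variable {m n : ℕ} {p x : Fin m → Fin n → ℚ}

theorem mul_add_inj {i i' j j' : ℕ} (hj : j < n) (hj' : j' < n) (h : i * n + j = i' * n + j') :
    i = i' ∧ j = j' := by
  have h1 : ∀ a b : ℕ, b < n → (a * n + b) / n = a := fun a b hb => by
    rw [mul_comm, Nat.mul_add_div (by omega), Nat.div_eq_of_lt hb, add_zero]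
  have hi : i = i' := by rw [← h1 i j hj, h, h1 i' j' hj']
  subst hi
  exact ⟨rfl, by omega⟩

theorem mul_add_div (i : ℕ) (j : Fin n) : (i * n + j) / n = i := by
  rw [mul_comm, Nat.mul_add_div j.pos, Nat.div_eq_of_lt j.2, add_zero]

theorem mul_add_mod (i : ℕ) (j : Fin n) : (i * n + j) % n = j := by
  rw [mul_comm, Nat.mul_add_mod, Nat.mod_eq_of_lt j.2]

theorem mul_add_lt (i : Fin m) (j : Fin n) : (i * n + j : ℕ) < m * n := by
  have := i.2
  have := j.2
  nlinarith

theorem rowMajor_apply (A : Fin m → Fin n → ℤ) (i : Fin m) (j : Fin n) :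
    rowMajor A ((i * n + j : ℕ) : ℤ) = A i j := by
  unfold rowMajor
  rw [sum_eq_single i, sum_eq_single j]
  · simp
  · intro l _ hl
    rw [if_neg]
    intro h
    exact hl (Fin.ext (mul_add_inj j.2 l.2 (by exact_mod_cast h)).2.symm)
  · simp
  · intro i' _ hi'
    refine sum_eq_zero fun l _ => ?_
    rw [if_neg]
    intro h
    exact hi' (Fin.ext (mul_add_inj j.2 l.2 (by exact_mod_cast h)).1.symm)
  · simp

theorem natAbs_rowMajor_le {A : Fin m → Fin n → ℤ} {B : ℕ} (hA : ∀ i j, (A i j).natAbs ≤ B)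
    (k : ℤ) : (rowMajor A k).natAbs ≤ B := by
  by_cases h : ∃ (i : Fin m) (j : Fin n), k = (i : ℤ) * n + j
  · obtain ⟨i, j, rfl⟩ := h
    have := rowMajor_apply A i j
    push_cast at this
    rw [this]
    exact hA i j
  · push Not at h
    rw [rowMajor, sum_eq_zero fun i _ => sum_eq_zero fun j _ => if_neg (h i j)]
    simp

theorem sum_range_mul (g : ℕ → ℕ) (m n : ℕ) :
    ∑ k ∈ range (m * n), g k = ∑ i : Fin m, ∑ j : Fin n, g (i * n + j) := by
  rw [← Fin.sum_univ_eq_sum_range, ← Equiv.sum_comp finProdFinEquiv, Fintype.sum_prod_type]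
  simp [finProdFinEquiv, add_comm, mul_comm]

theorem exists_index {k : ℕ} (hk : k < m * n) :
    ∃ (i : Fin m) (j : Fin n), k = i * n + j := by
  have hn : 0 < n := Nat.pos_of_mul_pos_left (by omega : 0 < m * n)
  refine ⟨⟨k / n, Nat.div_lt_of_lt_mul (by rwa [mul_comm])⟩, ⟨k % n, Nat.mod_lt _ hn⟩, ?_⟩
  simp [Nat.div_add_mod']

/-- The tables of the numerators and denominators of a rational input. -/
def inputTables (p x : Fin m → Fin n → ℚ) : Tables where
  m := m
  n := n
  pNum k := rowMajor (fun i j => (p i j).num) k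
  pDen k := rowMajor (fun i j => ((p i j).den : ℤ)) k
  xNum k := rowMajor (fun i j => (x i j).num) k
  xDen k := rowMajor (fun i j => ((x i j).den : ℤ)) k

theorem heldBy_inputMem (p x : Fin m → Fin n → ℚ) : (inputTables p x).HeldBy (inputMem p x) := by
  constructor <;> simp [inputMem, inputTables]

/-! #### Scaled integers and rationals -/

theorem prod_rowMajor_pos (q : Fin m → Fin n → ℚ) :
    0 < ∏ k ∈ range (m * n), rowMajor (fun i j => ((q i j).den : ℤ)) k := by
  refine prod_pos fun k hk => ?_
  obtain ⟨i, j, rfl⟩ := exists_index (mem_range.1 hk)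
  rw [rowMajor_apply]
  exact_mod_cast (q i j).den_pos

/-- Each denominator divides the common one, so the integer division is exact. -/
theorem cast_scaled (q : Fin m → Fin n → ℚ) (i : Fin m) (j : Fin n) {D : ℤ}
    (hD : D = ∏ k ∈ range (m * n), rowMajor (fun i j => ((q i j).den : ℤ)) k) :
    ((rowMajor (fun i j => (q i j).num) ((i * n + j : ℕ) : ℤ) *
      (D / rowMajor (fun i j => ((q i j).den : ℤ)) ((i * n + j : ℕ) : ℤ)) : ℤ) : ℝ) =
      (q i j : ℝ) * D := by
  have hdvd : rowMajor (fun i j => ((q i j).den : ℤ)) ((i * n + j : ℕ) : ℤ) ∣ D := by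
    rw [hD]
    exact dvd_prod_of_mem (fun k : ℕ => rowMajor (fun i j => ((q i j).den : ℤ)) k)
      (mem_range.2 (mul_add_lt i j))
  rw [rowMajor_apply] at hdvd ⊢
  rw [rowMajor_apply]
  have h0 : ((q i j).den : ℝ) ≠ 0 := by exact_mod_cast (q i j).den_ne_zero
  rw [Int.cast_mul, Int.cast_div hdvd (by exact_mod_cast (q i j).den_ne_zero),
    Rat.cast_def (q i j)]
  push_cast
  field_simp

theorem pScale_pos (p x : Fin m → Fin n → ℚ) : (0 : ℝ) < (inputTables p x).pScale := by
  exact_mod_cast prod_rowMajor_pos p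

theorem xScale_pos (p x : Fin m → Fin n → ℚ) : (0 : ℝ) < (inputTables p x).xScale := by
  exact_mod_cast prod_rowMajor_pos x

theorem cast_proc (p x : Fin m → Fin n → ℚ) (i : Fin m) (j : Fin n) :
    ((inputTables p x).proc (i * n + j) : ℝ) = p i j * (inputTables p x).pScale :=
  cast_scaled p i j rfl

theorem cast_frac (p x : Fin m → Fin n → ℚ) (i : Fin m) (j : Fin n) :
    ((inputTables p x).frac (i * n + j) : ℝ) = x i j * (inputTables p x).xScale :=
  cast_scaled x i j rfl

theorem cast_cost (p x : Fin m → Fin n → ℚ) (j : Fin n) :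
    ((inputTables p x).cost j : ℝ) = jobCost (fun i j => (p i j : ℝ)) (fun i j => (x i j : ℝ)) j *
      ((inputTables p x).pScale * (inputTables p x).xScale) := by
  rw [Tables.cost, jobCost, sum_mul, Int.cast_sum]
  change ∑ i ∈ range m, (((inputTables p x).proc (i * n + j) *
    (inputTables p x).frac (i * n + j) : ℤ) : ℝ) = _
  rw [← Fin.sum_univ_eq_sum_range (fun i => (((inputTables p x).proc (i * n + j) *
    (inputTables p x).frac (i * n + j) : ℤ) : ℝ))]
  refine sum_congr rfl fun i _ => ?_
  rw [Int.cast_mul, cast_proc, cast_frac]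
  ring

theorem cast_capped (p x : Fin m → Fin n → ℚ) (i : Fin m) (j : Fin n) :
    ((inputTables p x).capped (i * n + j) : ℝ) =
      cappedFiltered (fun i j => (p i j : ℝ)) (fun i j => (x i j : ℝ)) i j *
        (inputTables p x).xScale := by
  have hP := pScale_pos p x
  have hX := xScale_pos p x
  have hc := cast_cost p x j
  have hp := cast_proc p x i j
  have hf := cast_frac p x i j
  have hmod : (i * n + j) % (inputTables p x).n = j := mul_add_mod i j
  have h1 : 0 < 2 * (inputTables p x).cost j -
      (inputTables p x).proc (i * n + j) * (inputTables p x).xScale + 1 ↔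
      (p i j : ℝ) ≤ 2 * jobCost (fun i j => (p i j : ℝ)) (fun i j => (x i j : ℝ)) j := by
    rw [Int.lt_add_one_iff, sub_nonneg, ← Int.cast_le (R := ℝ), Int.cast_mul, Int.cast_mul, hc, hp,
      mul_assoc, Int.cast_ofNat, ← mul_assoc 2, mul_le_mul_iff_of_pos_right (mul_pos hP hX)]
  have h2 : 0 < 2 * (inputTables p x).frac (i * n + j) - (inputTables p x).xScale ↔
      (1 : ℝ) < 2 * x i j := by
    rw [sub_pos, ← Int.cast_lt (R := ℝ), Int.cast_mul, hf, Int.cast_ofNat, ← mul_assoc,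
      lt_mul_iff_one_lt_left hX]
  rw [Tables.capped, hmod, cappedFiltered, filtered]
  simp only [h1, h2]
  split_ifs with c1 c2
  · rw [min_eq_right c2.le, one_mul]
  · rw [min_eq_left (not_lt.1 c2), Int.cast_mul, hf]
    push_cast
    ring
  · simp

theorem cast_shift (p x : Fin m → Fin n → ℚ) (i : Fin m) (j l : Fin n) :
    ((inputTables p x).shift (i * n + j) l : ℝ) =
      if lengthKey (fun j => (p i j : ℝ)) l < lengthKey (fun j => (p i j : ℝ)) j then
        cappedFiltered (fun i j => (p i j : ℝ)) (fun i j => (x i j : ℝ)) i l *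
          (inputTables p x).xScale else 0 := by
  have hP := pScale_pos p x
  have hj := cast_proc p x i j
  have hl := cast_proc p x i l
  have hmod : (i * n + j) % (inputTables p x).n = j := mul_add_mod i j
  have hdiv : (i * n + j) / (inputTables p x).n = i := mul_add_div i j
  have hn : (inputTables p x).n = n := rfl
  have h1 : 0 < ((inputTables p x).proc (i * n + l) - (inputTables p x).proc (i * n + j)) * n +
      ((((j : ℕ)) : ℤ) - (l : ℕ)) ↔
      lengthKey (fun j => (p i j : ℝ)) l < lengthKey (fun j => (p i j : ℝ)) j := by
    have hjn : ((j : ℕ) : ℤ) < n := by exact_mod_cast j.2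
    have hln : ((l : ℕ) : ℤ) < n := by exact_mod_cast l.2
    have hlt : ((p i j : ℝ) < p i l ↔
        (inputTables p x).proc (i * n + j) < (inputTables p x).proc (i * n + l)) := by
      rw [← Int.cast_lt (R := ℝ), hj, hl, mul_lt_mul_iff_of_pos_right hP]
    have heq : ((p i j : ℝ) = p i l ↔
        (inputTables p x).proc (i * n + j) = (inputTables p x).proc (i * n + l)) := by
      rw [← Int.cast_inj (α := ℝ), hj, hl, mul_left_inj' hP.ne']
    rw [lengthKey_lt, hlt, heq, Fin.lt_def]
    generalize (inputTables p x).proc (i * n + j) = a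
    generalize (inputTables p x).proc (i * n + l) = b
    rcases lt_trichotomy a b with h | h | h
    · refine ⟨fun _ => .inl h, fun _ => ?_⟩
      nlinarith
    · subst h
      simp
    · refine ⟨fun h' => ?_, fun h' => ?_⟩
      · nlinarith
      · omega
  rw [Tables.shift, hmod, hdiv, hn]
  simp only [h1]
  split_ifs
  · exact cast_capped p x i l
  · simp

theorem cast_pos (p x : Fin m → Fin n → ℚ) (i : Fin m) (j : Fin n) :
    ((inputTables p x).pos (i * n + j) : ℝ) =
      start (lengthKey (fun j => (p i j : ℝ)))
        (cappedFiltered (fun i j => (p i j : ℝ)) (fun i j => (x i j : ℝ)) i) j *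
          (inputTables p x).xScale := by
  rw [Tables.pos, start, sum_filter, sum_mul, Int.cast_sum]
  change ∑ l ∈ range n, _ = _
  rw [← Fin.sum_univ_eq_sum_range (fun l => (((inputTables p x).shift (i * n + j) l : ℤ) : ℝ))]
  refine sum_congr rfl fun l _ => ?_
  rw [cast_shift, ite_mul, zero_mul]

/-- The bridge between program and geometry: the slot graph on integers is the real one with lengths
multiplied by the positive `xScale`. -/
theorem adj_iff (p x : Fin m → Fin n → ℚ) (i : Fin m) (j s : Fin n) :
    (inputTables p x).Adj j (i * n + s) ↔ SlotAdj (fun i j => (p i j : ℝ))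
      (cappedFiltered (fun i j => (p i j : ℝ)) (fun i j => (x i j : ℝ))) j i s := by
  have hX := xScale_pos p x
  have hmod : (i * n + s) % (inputTables p x).n = s := mul_add_mod i s
  have hdiv : (i * n + s) / (inputTables p x).n = i := mul_add_div i s
  have hn : (inputTables p x).n = n := rfl
  rw [Tables.Adj, SlotAdj, Meets, hmod, hdiv, hn]
  refine and_congr ?_ (and_congr ?_ ?_)
  · rw [← Int.cast_pos (R := ℝ), cast_capped, mul_pos_iff_of_pos_right hX]
  · rw [sub_pos, ← Int.cast_lt (R := ℝ), cast_pos]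
    push_cast
    exact mul_lt_mul_iff_of_pos_right hX
  · rw [sub_pos, ← Int.cast_lt (R := ℝ), Int.cast_add, cast_pos, cast_capped, ← add_mul]
    push_cast
    exact mul_lt_mul_iff_of_pos_right hX

/-! #### Sizes -/

theorem ratLen_le_inputSize (p x : Fin m → Fin n → ℚ) (i : Fin m) (j : Fin n) :
    ratLen (p i j) + ratLen (x i j) ≤ inputSize p x := by
  have h1 := single_le_sum (f := fun i => ∑ j, (ratLen (p i j) + ratLen (x i j)))
    (fun _ _ => Nat.zero_le _) (mem_univ i)
  have h2 := single_le_sum (f := fun j => ratLen (p i j) + ratLen (x i j))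
    (fun _ _ => Nat.zero_le _) (mem_univ j)
  unfold inputSize
  omega

theorem mul_le_inputSize (p x : Fin m → Fin n → ℚ) : m * n ≤ inputSize p x := by
  have h : ∑ i : Fin m, ∑ j : Fin n, 1 ≤ ∑ i, ∑ j, (ratLen (p i j) + ratLen (x i j)) :=
    sum_le_sum fun i _ => sum_le_sum fun j _ => by
      simp only [ratLen, bitLen]
      omega
  simp only [sum_const, card_univ, Fintype.card_fin, smul_eq_mul, mul_one] at h
  unfold inputSize
  omega

theorem natAbs_le_two_pow {z : ℤ} {s : ℕ} (h : bitLen z ≤ s) : z.natAbs ≤ 2 ^ s :=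
  (Nat.size_le.1 ((Nat.le_succ _).trans h)).le

theorem natAbs_num_le {q : ℚ} {s : ℕ} (h : ratLen q ≤ s) : q.num.natAbs ≤ 2 ^ s :=
  natAbs_le_two_pow ((Nat.le_add_right _ _).trans h)

theorem natAbs_den_le {q : ℚ} {s : ℕ} (h : ratLen q ≤ s) : (q.den : ℤ).natAbs ≤ 2 ^ s :=
  natAbs_le_two_pow ((Nat.le_add_left _ _).trans h)

/-- Bit lengths add up under multiplication, so the plain product of all denominators is short
enough as a common denominator. -/
theorem natAbs_prod_den_le {q : Fin m → Fin n → ℚ} {s : ℕ} (h : ∑ i, ∑ j, ratLen (q i j) ≤ s)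
    {k : ℕ} (hk : k ≤ m * n) :
    (∏ l ∈ range k, rowMajor (fun i j => ((q i j).den : ℤ)) l).natAbs ≤ 2 ^ s := by
  set g : ℕ → ℤ := fun l => rowMajor (fun i j => ((q i j).den : ℤ)) l
  have h1 : (∏ l ∈ range k, g l).natAbs ≤ 2 ^ ∑ l ∈ range k, bitLen (g l) := by
    rw [← prod_pow_eq_pow_sum, ← Int.natAbsHom_apply, map_prod]
    exact prod_le_prod' fun l _ => natAbs_le_two_pow le_rfl
  have h2 : ∑ l ∈ range k, bitLen (g l) ≤ s := by
    calc ∑ l ∈ range k, bitLen (g l) ≤ ∑ l ∈ range (m * n), bitLen (g l) :=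
          sum_le_sum_of_subset (range_subset_range.2 hk)
      _ = ∑ i : Fin m, ∑ j : Fin n, bitLen ((q i j).den : ℤ) := by
          rw [sum_range_mul]
          refine sum_congr rfl fun i _ => sum_congr rfl fun j _ => ?_
          rw [show g (i * n + j) = _ from rowMajor_apply _ i j]
      _ ≤ ∑ i, ∑ j, ratLen (q i j) :=
          sum_le_sum fun i _ => sum_le_sum fun j _ => Nat.le_add_left _ _
      _ ≤ s := h
  exact h1.trans (Nat.pow_le_pow_right two_pos h2)

theorem natAbs_sum_range_le {g : ℕ → ℤ} {B K k : ℕ} (hk : k ≤ K)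
    (hg : ∀ i < K, (g i).natAbs ≤ B) : (∑ i ∈ range k, g i).natAbs ≤ K * B := by
  refine (Int.natAbs_sum_le _ _).trans ((sum_le_card_nsmul _ _ B fun i hi => ?_).trans ?_)
  · exact hg i ((mem_range.1 hi).trans_le hk)
  · simpa using Nat.mul_le_mul_right B hk

theorem inputMem_boundedBy (p x : Fin m → Fin n → ℚ) {W : ℕ} (hW : 2 ^ inputSize p x ≤ W) :
    (inputMem p x).BoundedBy W := by
  have h := ratLen_le_inputSize p x
  have hp : ∀ i j, ratLen (p i j) ≤ inputSize p x := fun i j => by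
    have := h i j
    omega
  have hx : ∀ i j, ratLen (x i j) ≤ inputSize p x := fun i j => by
    have := h i j
    omega
  have hm : bitLen m ≤ inputSize p x := by
    unfold inputSize
    omega
  have hn : bitLen n ≤ inputSize p x := by
    unfold inputSize
    omega
  intro a k
  refine le_trans ?_ hW
  match a with
  | 0 =>
    simp only [inputMem]
    split_ifs
    · exact natAbs_le_two_pow hm
    · exact natAbs_le_two_pow hn
    · simp
  | 1 => exact natAbs_rowMajor_le (fun i j => natAbs_num_le (hp i j)) k
  | 2 => exact natAbs_rowMajor_le (fun i j => natAbs_den_le (hp i j)) k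
  | 3 => exact natAbs_rowMajor_le (fun i j => natAbs_num_le (hx i j)) k
  | 4 => exact natAbs_rowMajor_le (fun i j => natAbs_den_le (hx i j)) k
  | _ + 5 => simp [inputMem]

/-- With `s` the input size, scaled entries are at most `2 ^ (2 * s)`. A job cost sums at most `2 ^
s` products of two of them, which accounts for the `5`; everything else is smaller. -/
theorem inputTables_boundedBy (p x : Fin m → Fin n → ℚ) :
    (inputTables p x).BoundedBy (2 ^ (5 * inputSize p x)) := by
  set s := inputSize p x with hs
  have hsum : ∑ i, ∑ j, ratLen (p i j) + ∑ i, ∑ j, ratLen (x i j) ≤ s := by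
    rw [hs, inputSize]
    simp only [sum_add_distrib]
    omega
  have hs1 : 1 ≤ s := by
    rw [hs, inputSize, bitLen]
    omega
  have hpow : ∀ {a b : ℕ}, a ≤ b → 2 ^ a ≤ 2 ^ b := fun h => Nat.pow_le_pow_right two_pos h
  have hm : m ≤ 2 ^ s := natAbs_le_two_pow (z := m) (by
    rw [hs, inputSize]
    omega)
  have hn : n ≤ 2 ^ s := natAbs_le_two_pow (z := n) (by
    rw [hs, inputSize]
    omega)
  have hP : ∀ k ≤ m * n, (∏ l ∈ range k, (inputTables p x).pDen l).natAbs ≤ 2 ^ s :=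
    fun k hk => natAbs_prod_den_le (by omega) hk
  have hX : ∀ k ≤ m * n, (∏ l ∈ range k, (inputTables p x).xDen l).natAbs ≤ 2 ^ s :=
    fun k hk => natAbs_prod_den_le (by omega) hk
  have hPs : (inputTables p x).pScale.natAbs ≤ 2 ^ s := hP _ le_rfl
  have hXs : (inputTables p x).xScale.natAbs ≤ 2 ^ s := hX _ le_rfl
  have hmem := inputMem_boundedBy p x le_rfl
  have hproc : ∀ k, ((inputTables p x).proc k).natAbs ≤ 2 ^ (2 * s) := by
    intro k
    rw [Tables.proc, Int.natAbs_mul, two_mul, pow_add]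
    exact Nat.mul_le_mul (hmem 1 k) ((Int.natAbs_ediv_le_natAbs _ _).trans hPs)
  have hfrac : ∀ k, ((inputTables p x).frac k).natAbs ≤ 2 ^ (2 * s) := by
    intro k
    rw [Tables.frac, Int.natAbs_mul, two_mul, pow_add]
    exact Nat.mul_le_mul (hmem 3 k) ((Int.natAbs_ediv_le_natAbs _ _).trans hXs)
  have hcap : ∀ k, ((inputTables p x).capped k).natAbs ≤ 2 ^ (3 * s) := by
    intro k
    rw [Tables.capped]
    split_ifs
    · exact hXs.trans (hpow (by omega))
    · rw [Int.natAbs_mul]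
      refine (Nat.mul_le_mul_left 2 (hfrac k)).trans ?_
      rw [← pow_succ']
      exact hpow (by omega)
    · simp
  have hshift : ∀ k j, ((inputTables p x).shift k j).natAbs ≤ 2 ^ (3 * s) := by
    intro k j
    rw [Tables.shift]
    split_ifs
    · exact hcap _
    · simp
  constructor
  · exact fun k hk => (hP k hk).trans (hpow (by omega))
  · exact fun k hk => (hX k hk).trans (hpow (by omega))
  · intro j _ k hk
    refine (natAbs_sum_range_le (B := 2 ^ (2 * s) * 2 ^ (2 * s)) hk fun i _ => ?_).trans ?_
    · rw [Int.natAbs_mul]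
      exact Nat.mul_le_mul (hproc _) (hfrac _)
    · refine (Nat.mul_le_mul_right _ hm).trans ?_
      rw [← pow_add, ← pow_add]
      exact hpow (by omega)
  · exact fun k _ => (hcap k).trans (hpow (by omega))
  · intro k _ l hl
    refine (natAbs_sum_range_le hl fun j _ => hshift k j).trans
      ((Nat.mul_le_mul_right _ hn).trans ?_)
    rw [← pow_add]
    exact hpow (by omega)
  · exact hm.trans (hpow (by omega))
  · exact hn.trans (hpow (by omega))
  · refine (Nat.mul_le_mul hm hn).trans ?_
    rw [← pow_add]
    exact hpow (by omega)

/-- The running time of the rounding program as a polynomial in the input size. -/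
noncomputable def roundTime : Polynomial ℕ :=
  -- Loops run at most `s ^ 2` times, the `m * n * n` bids being the bottleneck; `5 * s + 2` is the
  -- word length belonging to the bound `2 ^ (5 * s)`.
  roundProg.timeBound.comp (.X ^ 2) * (5 * .X + 2)

/-! ### Time and correctness of the whole program -/

theorem roundTime_eval (s : ℕ) :
    roundTime.eval s = roundProg.timeBound.eval (s ^ 2) * ((2 ^ (5 * s)).size + 1) := by
  rw [Nat.size_pow]
  simp [roundTime]

theorem roundProg_spec (hmn : m ≤ n) (hp : ∀ i j, 0 ≤ p i j)
    (hx : IsFractionalAssignment (fun i j => (x i j : ℝ))) :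
    ∃ σ : Fin n → Fin m, Outputs roundProg p x σ (roundTime.eval (inputSize p x)) ∧
      IsRounding (fun i j => (p i j : ℝ)) (fun i j => (x i j : ℝ)) σ := by
  have hp' : ∀ i j, (0 : ℝ) ≤ p i j := fun i j => by exact_mod_cast hp i j
  set s := inputSize p x
  have hcell : m * n ≤ s := mul_le_inputSize p x
  -- The encoding of the number `n` alone is only logarithmic in `n`. But a job can be covered only
  -- if there is a machine, and then `n ≤ m * n`.
  have hns : n ≤ s := by
    rcases Nat.eq_zero_or_pos n with h0 | h0
    · omega
    · have hm : 0 < m := by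
        rcases Nat.eq_zero_or_pos m with rfl | h
        · exact absurd (hx.covers ⟨0, h0⟩) (by simp)
        · exact h
      nlinarith
  have hss : s ≤ s ^ 2 := Nat.le_self_pow two_ne_zero s
  obtain ⟨μ, hμinj, hμ⟩ := exists_slots_cappedFiltered hp' hx
  let ν : ℕ → ℕ := fun j => if h : j < n then (μ ⟨j, h⟩).1 * n + (μ ⟨j, h⟩).2 else 0
  have hν : ∀ j : Fin n, ν j = (μ j).1 * n + (μ j).2 := fun j => by simp [ν]
  have hrun := runs_roundProg (d := inputTables p x) (N := s ^ 2) (μ := ν)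
    (inputTables_boundedBy p x) (show m ≤ s ^ 2 by omega) (show n ≤ s ^ 2 by omega)
    (show m * n ≤ s ^ 2 by omega)
    (show m * n * n ≤ s ^ 2 by
      rw [sq]
      exact Nat.mul_le_mul hcell hns)
    (inputMem_boundedBy p x (Nat.pow_le_pow_right two_pos (by omega))) (heldBy_inputMem p x)
    (fun a ha k => by
      obtain ⟨b, rfl⟩ := Nat.exists_eq_add_of_le' ha
      rfl)
    (fun j hj => by
      rw [hν ⟨j, hj⟩]
      exact ⟨mul_add_lt _ _, (adj_iff p x _ ⟨j, hj⟩ _).2 (hμ ⟨j, hj⟩)⟩)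
    (fun j hj l hl h => by
      have hj' : j < n := hj
      have hl' : l < n := hl
      rw [hν ⟨j, hj'⟩, hν ⟨l, hl'⟩] at h
      obtain ⟨h1, h2⟩ := mul_add_inj (Fin.is_lt _) (Fin.is_lt _) h
      simpa using hμinj (Prod.ext (Fin.ext h1) (Fin.ext h2)))
  obtain ⟨M', t, hexec, ht, -, slot, hinj, hslot⟩ := hrun
  change Set.InjOn slot (Set.Iio n) at hinj
  change ∀ j < n, slot j < m * n ∧ _ ∧ M' 5 j = ((slot j / n : ℕ) : ℤ) at hslot
  have hidx : ∀ j : Fin n, ∃ (i : Fin m) (r : Fin n), slot j = i * n + r :=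
    fun j => exists_index (hslot j j.2).1
  choose σ r hσ using hidx
  refine ⟨σ, ⟨M', t, hexec, ?_, fun j => ?_⟩, ?_⟩
  · rw [roundTime_eval]
    exact ht
  · rw [(hslot j j.2).2.2, hσ j, mul_add_div]
  · refine isRounding_of_slots (slot := fun j => r j) hmn hp' hx.nonneg ?_ fun j => ?_
    · intro j l h
      simp only [Prod.mk.injEq] at h
      exact Fin.ext (hinj (Set.mem_Iio.2 j.2) (Set.mem_Iio.2 l.2) (by rw [hσ, hσ, h.1, h.2]))
    · have h := (hslot j j.2).2.1
      rw [hσ j] at h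
      exact (adj_iff p x _ j _).1 h

end Input

end MinNorm

theorem theorem3 :
    -- a polynomial-time algorithm for rational data, which sees neither the norm nor the value `T`
    (∃ (c : MinNorm.Prog) (q : Polynomial ℕ), ∀ (m n : ℕ), m ≤ n →
      ∀ p x : Fin m → Fin n → ℚ, (∀ i j, 0 ≤ p i j) →
        MinNorm.IsFractionalAssignment (fun i j => (x i j : ℝ)) →
        ∃ σ : Fin n → Fin m,
          MinNorm.Outputs c p x σ (q.eval (MinNorm.inputSize p x)) ∧
          MinNorm.IsRounding (fun i j => (p i j : ℝ)) (fun i j => (x i j : ℝ)) σ) ∧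
    -- the same guarantee for arbitrary real data
    (∀ (m n : ℕ), m ≤ n →
      ∀ p x : Fin m → Fin n → ℝ, (∀ i j, 0 ≤ p i j) → MinNorm.IsFractionalAssignment x →
        ∃ σ : Fin n → Fin m, MinNorm.IsRounding p x σ) := by
  exact ⟨⟨MinNorm.roundProg, MinNorm.roundTime, fun _ _ hmn _ _ hp hx =>
    MinNorm.roundProg_spec hmn hp hx⟩, fun _ _ hmn _ _ hp hx =>
    MinNorm.exists_isRounding hmn hp hx⟩
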